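/- Let $k$ be a field of characteristic $0$ and $n\in\mathbb Z$. A finite-dimensional formal moduli problem $X$ is given by a finite-dimensional $L_\infty$ algebra $\mathfrak g$ over $k$, that is, by a degree $1$ formal vector field $Q_{\mathfrak g}$ on $\mathfrak g[1]$ vanishing at $0$ with $[Q_{\mathfrak g},Q_{\mathfrak g}]=0$. A strict constant-coefficient $n$-shifted symplectic structure on $X$ is a graded antisymmetric nondegenerate pairing $\omega$ of degree $-n$ on $\mathfrak g[1]$ (equivalently, a symmetric isomorphism $\mathfrak g\to\mathfrak g^*[n-2]$) such that $\mathcal L_{Q_{\mathfrak g}}\omega=0$. A regular embedded Lagrangian $L_+\hookrightarrow X$ is an injective strict $L_\infty$ map $f:\mathfrak l_+\to\mathfrak g$ from a finite-dimensional $L_\infty$ algebra with $f(\mathfrak l_+)=f(\mathfrak l_+)^{\perp_\omega}$. Polyvector fields $\Gamma(L_+,\widehat{\mathrm{Sym}}^\bullet(\mathbb T_{L_+}[-n]))$ are identified with formal functions on $\mathfrak l_+[1]\oplus(\mathfrak l_+[1])^*[n]$, with $\mathrm{Sym}^j$ corresponding to degree $j$ in the fibre $(\mathfrak l_+[1])^*[n]$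 and the Schouten bracket $[\cdot,\cdot]$ to the Poisson bracket of the canonical $n$-shifted symplectic form $\omega_{\mathrm{can}}$. An $(n-1)$-shifted homotopy Poisson structure on $L_+$ is $\bar\Pi=(\Pi_j)_{j\ge 2}$ with $\Pi_j\in\Gamma(L_+,\mathrm{Sym}^j(\mathbb T_{L_+}[-n]))$ of cohomological degree $n+1$ and $[Q_{\mathfrak l_+}+\bar\Pi,\,Q_{\mathfrak l_+}+\bar\Pi]=0$. For $\bar\Pi$ a polyvector field of this kind (with components $j\ge2$, of degree $n+1$), $T^*_{\bar\Pi}[n]L_+$ denotes $\mathfrak l_+[1]\oplus(\mathfrak l_+[1])^*[n]$ with the Hamiltonian vector field of $Q_{\mathfrak l_+}+\bar\Pi$; $T^*[n]L_+$ is the case $\bar\Pi=0$. A symplectic splitting is a degree-preserving linear isomorphism $\Phi:\mathfrak l_+[1]\oplus(\mathfrak l_+[1])^*[n]\to\mathfrak g[1]$ with $\Phi|_{\mathfrak l_+[1]}=f$ and $\Phi^*\omega=\omega_{\mathrm{can}}$. **Proposition.** Let $(X,\omega)$ be a finite-dimensional formal moduli problem with a strict constant-coefficient $n$-shifted symplectic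 structure and $L_+\hookrightarrow X$ a regular embedded Lagrangian. Then: 1. The map $w\mapsto\omega(w,f(-))$ from $f^*\mathbb T_X$ to $\mathbb L_{L_+}[n]$ is a surjective map of vector bundles on $L_+$ with kernel $\mathbb T_{L_+}$; thus the total space of the normal bundle of $L_+$ in $X$ is $T^*[n]L_+$. 2. Graded isotropic complements $\mathfrak l_-$ of $f(\mathfrak l_+)$ in $\mathfrak g$ exist, and each determines a unique symplectic splitting $\Phi$ with $\Phi((\mathfrak l_+[1])^*[n])\subseteq\mathfrak l_-[1]$. 3. For each symplectic splitting $\Phi$ there is a unique polyvector field $\bar\Pi=(\Pi_j)_{j\ge2}$ of cohomological degree $n+1$ such that $\Phi$ is a strict isomorphism $T^*_{\bar\Pi}[n]L_+\cong X$, and $\bar\Pi$ is an $(n-1)$-shifted homotopy Poisson structure on $L_+$. 4. $\bar\Pi$ is given by the deformation to the normal cone $T^*[n]L_+\rightsquigarrow X$: for every $c\in k$ the polyvector field $\bar\Pi^{(c)}=\sum_{j\ge2}c^{j-1}\Pi_j$ is an $(n-1)$-shifted homotopy Poisson structure, with $\bar\Pi^{(0)}=0$, $\bar\Pi^{(1)}=\bar\Pi$,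 and for $c\ne0$ the map $\Phi\circ(\mathrm{id}\oplus c\cdot\mathrm{id})$ is a strict isomorphism $T^*_{\bar\Pi^{(c)}}[n]L_+\cong X$. 5. $\bar\Pi$ is natural: if $\bar\Pi,\bar\Pi'$ arise from two symplectic splittings, there is a polyvector field $B$ of cohomological degree $n$ with components in $\mathrm{Sym}^j(\mathbb T_{L_+}[-n])$, $j\ge2$, such that $Q_{\mathfrak l_+}+\bar\Pi'=e^{[B,\cdot]}(Q_{\mathfrak l_+}+\bar\Pi)$; and strict isomorphisms $\psi:X\to X'$, $\chi:L_+\to L_+'$ with $\psi^*\omega'=\omega$ and $\psi f=f'\chi$ carry the structure $\bar\Pi$ of a splitting $\Phi$ to the structure $\chi_*\bar\Pi$ of the transported splitting. -/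

import Mathlib

universe u v

namespace FormalModuli

noncomputable section

/-! ### Graded vector spaces -/

/-- A `ℤ`-grading of a `k`-vector space. -/
structure Grading (k : Type*) [Field k] (V : Type*) [AddCommGroup V] [Module k V] where
  deg : ℤ → Submodule k V
  internal : DirectSum.IsInternal deg

namespace Grading

variable {k : Type*} [Field k] {V : Type*} [AddCommGroup V] [Module k V]

/-- The direct sum decomposition of `V`. -/
def decomp (𝒱 : Grading k V) : DirectSum ℤ (fun i => 𝒱.deg i) ≃ₗ[k] V :=
  LinearEquiv.ofBijective (DirectSum.coeLinearMap 𝒱.deg) 𝒱.internal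

theorem decomp_lof (𝒱 : Grading k V) (i : ℤ) (x : 𝒱.deg i) :
    𝒱.decomp (DirectSum.lof k ℤ (fun i => 𝒱.deg i) i x) = x :=
  DirectSum.coeLinearMap_lof 𝒱.deg i x

/-- The operator that multiplies the degree `i` component by `c i`. -/
def act (𝒱 : Grading k V) (c : ℤ → k) : V →ₗ[k] V :=
  𝒱.decomp.toLinearMap ∘ₗ
    DirectSum.lmap (fun i => c i • (LinearMap.id : 𝒱.deg i →ₗ[k] 𝒱.deg i)) ∘ₗ
      𝒱.decomp.symm.toLinearMap

theorem act_of_mem (𝒱 : Grading k V) (c : ℤ → k) {i : ℤ} {x : V} (hx : x ∈ 𝒱.deg i) :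
    𝒱.act c x = c i • x := by
  have h : 𝒱.decomp.symm x = DirectSum.lof k ℤ (fun i => 𝒱.deg i) i ⟨x, hx⟩ := by
    rw [LinearEquiv.symm_apply_eq, decomp_lof]
  simp only [act, LinearMap.comp_apply, LinearEquiv.coe_coe, h, DirectSum.lmap_lof, decomp_lof]
  simp

/-- Projection to the odd part (`b = true`) or to the even part (`b = false`). -/
def parityProj (𝒱 : Grading k V) (b : Bool) : V →ₗ[k] V :=
  𝒱.act fun i => if decide (Odd i) = b then 1 else 0

/-- The operator `x ↦ (-1) ^ (e * |x|) x`. -/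
def signOp (𝒱 : Grading k V) (e : ℤ) : V →ₗ[k] V :=
  𝒱.act fun i => ((((e * i).negOnePow : ℤˣ) : ℤ) : k)

theorem signOp_signOp (𝒱 : Grading k V) (e : ℤ) (x : V) :
    𝒱.signOp e (𝒱.signOp e x) = x := by
  have hx : x ∈ ⨆ i, 𝒱.deg i := by
    rw [𝒱.internal.submodule_iSup_eq_top]; trivial
  induction hx using Submodule.iSup_induction' with
  | mem i x hx =>
    simp only [signOp, 𝒱.act_of_mem _ hx, map_smul, smul_smul, ← Int.cast_mul, ← Units.val_mul,
      Int.units_mul_self]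
    simp
  | zero => simp
  | add x y _ _ h₁ h₂ => simp [h₁, h₂]

/-- The grading of `V^*[n]`: the degree `i` part consists of the functionals supported on the
component of `V` of degree `-i-n`. -/
def dualDeg (𝒱 : Grading k V) (n i : ℤ) : Submodule k (Module.Dual k V) where
  carrier := {ξ | ∀ j, j ≠ -i - n → ∀ x ∈ 𝒱.deg j, ξ x = 0}
  add_mem' := fun h₁ h₂ j hj x hx => by simp [h₁ j hj x hx, h₂ j hj x hx]
  zero_mem' := fun _ _ _ _ => rfl
  smul_mem' := fun c ξ h j hj x hx => by simp [h j hj x hx]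

/-- The graded vector space `V ⊕ V^*[n]`. -/
def cotangent [FiniteDimensional k V] (𝒱 : Grading k V) (n : ℤ) :
    Grading k (V × Module.Dual k V) where
  deg i := (𝒱.deg i).prod (𝒱.dualDeg n i)
  internal := by
    classical
    rw [DirectSum.isInternal_submodule_iff_iSupIndep_and_iSup_eq_top]
    let c : ℤ → ℤ → k := fun i j => if j = i then 1 else 0
    have hspan : ∀ x : V, x ∈ ⨆ i, 𝒱.deg i := fun x => by
      rw [𝒱.internal.submodule_iSup_eq_top]; trivial
    constructor
    · let P : ℤ → (V × Module.Dual k V) →ₗ[k] (V × Module.Dual k V) := fun i =>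
        (𝒱.act (c i)).prodMap (𝒱.act (c (-i - n))).dualMap
      have hP1 : ∀ i e, e ∈ (𝒱.deg i).prod (𝒱.dualDeg n i) → P i e = e := by
        rintro i ⟨x, ξ⟩ ⟨hx, hξ⟩
        refine Prod.ext ?_ ?_
        · simp [P, 𝒱.act_of_mem _ hx, c]
        · refine LinearMap.ext fun y => ?_
          have hy := hspan y
          change ξ (𝒱.act (c (-i - n)) y) = ξ y
          induction hy using Submodule.iSup_induction' with
          | mem j y hy =>
            rw [𝒱.act_of_mem _ hy]
            by_cases hj : j = -i - n
            · simp [c, hj]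
            · simp [c, hj, hξ j hj y hy]
          | zero => simp
          | add y z _ _ h₁ h₂ => simp [h₁, h₂]
      have hP0 : ∀ i j, j ≠ i → (𝒱.deg j).prod (𝒱.dualDeg n j) ≤ LinearMap.ker (P i) := by
        rintro i j hij ⟨x, ξ⟩ ⟨hx, hξ⟩
        rw [LinearMap.mem_ker]
        refine Prod.ext ?_ ?_
        · simp [P, 𝒱.act_of_mem _ hx, c, hij]
        · refine LinearMap.ext fun y => ?_
          have hy := hspan y
          change ξ (𝒱.act (c (-i - n)) y) = 0
          induction hy using Submodule.iSup_induction' with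
          | mem l y hy =>
            rw [𝒱.act_of_mem _ hy]
            by_cases hl : l = -i - n
            · simp [hξ l (by omega) y hy]
            · simp [c, hl]
          | zero => simp
          | add y z _ _ h₁ h₂ => simp [h₁, h₂]
      intro i
      rw [Submodule.disjoint_def]
      intro e he he'
      have h0 : P i e = 0 := LinearMap.mem_ker.1
        ((iSup₂_le fun j hj => hP0 i j hj : _ ≤ LinearMap.ker (P i)) he')
      rw [← hP1 i e he, h0]
    · rw [eq_top_iff]
      rintro ⟨x, ξ⟩ -
      have hx : ((x, 0) : V × Module.Dual k V) ∈
          ⨆ i, (𝒱.deg i).prod (𝒱.dualDeg n i) := by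
        have hx := hspan x
        induction hx using Submodule.iSup_induction' with
        | mem i x hx => exact Submodule.mem_iSup_of_mem i ⟨hx, Submodule.zero_mem _⟩
        | zero => exact Submodule.zero_mem _
        | add x y _ _ h₁ h₂ => simpa using Submodule.add_mem _ h₁ h₂
      have hξ : ((0, ξ) : V × Module.Dual k V) ∈
          ⨆ i, (𝒱.deg i).prod (𝒱.dualDeg n i) := by
        have hfin : {i | 𝒱.deg i ≠ ⊥}.Finite :=
          WellFoundedGT.finite_ne_bot_of_iSupIndep 𝒱.internal.submodule_iSupIndep
        have hsum : ((0, ξ) : V × Module.Dual k V) =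
            ∑ i ∈ hfin.toFinset, (0, ξ ∘ₗ 𝒱.act (c i)) := by
          refine Prod.ext (by simp [Prod.fst_sum]) (LinearMap.ext fun y => ?_)
          simp only [Prod.snd_sum, LinearMap.sum_apply, LinearMap.comp_apply]
          have hy := hspan y
          induction hy using Submodule.iSup_induction' with
          | mem j y hy =>
            simp only [𝒱.act_of_mem _ hy, map_smul, c]
            by_cases hj : 𝒱.deg j = ⊥
            · rw [hj, Submodule.mem_bot] at hy
              simp [hy]
            · rw [Finset.sum_eq_single j]
              · simp
              · intro b _ hb
                simp [Ne.symm hb]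
              · intro h
                exact absurd (hfin.mem_toFinset.2 hj) h
          | zero => simp
          | add y z _ _ h₁ h₂ => simp only [map_add, h₁, h₂, Finset.sum_add_distrib]
        rw [hsum]
        refine Submodule.sum_mem _ fun i _ => Submodule.mem_iSup_of_mem (-i - n) ?_
        refine ⟨Submodule.zero_mem _, fun j hj y hy => ?_⟩
        have : j ≠ i := by omega
        simp [𝒱.act_of_mem _ hy, c, this]
      simpa using Submodule.add_mem _ hx hξ

end Grading

/-! ### Formal functions and formal vector fields -/

/-- Formal maps `V → W` in Taylor coefficients: `φ` stands for the formal power series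
`∑ₘ φ m (x, …, x) / m!`.  Subject to graded symmetry, for `V` finite dimensional and `k` of
characteristic zero, these are the elements of `Sym^(V^*) ⊗ W`; the case `W = k` gives formal
functions, the case `W = V` formal vector fields. -/
abbrev FormalMap (k : Type*) [Field k] (V W : Type*) [AddCommGroup V] [Module k V]
    [AddCommGroup W] [Module k W] : Type _ :=
  ∀ m : ℕ, MultilinearMap k (fun _ : Fin m => V) W

section FormalMaps

variable {k : Type*} [Field k] {V : Type*} [AddCommGroup V] [Module k V]
  {W : Type*} [AddCommGroup W] [Module k W]

/-- Graded symmetry: exchanging two neighbouring homogeneous arguments of degrees `a`, `b`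
produces the sign `(-1) ^ (a * b)`. -/
def GradedSymm (𝒱 : Grading k V) (φ : FormalMap k V W) : Prop :=
  ∀ (m : ℕ) (v : Fin m → V) (i j : Fin m), (j : ℕ) = i + 1 →
    ∀ a b : ℤ, v i ∈ 𝒱.deg a → v j ∈ 𝒱.deg b →
      φ m (v ∘ Equiv.swap i j) = (a * b).negOnePow • φ m v

/-- A formal function is homogeneous of cohomological degree `d`. -/
def FunctionDegree (𝒱 : Grading k V) (d : ℤ) (φ : FormalMap k V k) : Prop :=
  ∀ (m : ℕ) (v : Fin m → V) (a : Fin m → ℤ), (∀ i, v i ∈ 𝒱.deg (a i)) →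
    d + ∑ i, a i ≠ 0 → φ m v = 0

/-- A formal vector field is homogeneous of cohomological degree `d`. -/
def FieldDegree (𝒱 : Grading k V) (d : ℤ) (Q : FormalMap k V V) : Prop :=
  ∀ (m : ℕ) (v : Fin m → V) (a : Fin m → ℤ), (∀ i, v i ∈ 𝒱.deg (a i)) →
    Q m v ∈ 𝒱.deg (d + ∑ i, a i)

/-- The Koszul sign of the unshuffle that moves the arguments indexed by `s` in front of the
others, when `p i` says whether the `i`-th argument is odd. -/
def koszulSign {m : ℕ} (s : Finset (Fin m)) (p : Fin m → Bool) : ℤ :=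
  ∏ x ∈ (sᶜ ×ˢ s).filter (fun x => x.1 < x.2), if p x.1 && p x.2 then -1 else 1

/-- The multilinear map `v ↦ φ (X (v_s), v_{sᶜ})`, where `v_s` lists the arguments indexed by
`s` in increasing order. -/
def insertOne (φ : FormalMap k V W) (X : FormalMap k V V) {m : ℕ} (s : Finset (Fin m)) :
    MultilinearMap k (fun _ : Fin m => V) W :=
  (MultilinearMap.curryFinFinset k W V (s := s) rfl rfl).symm
    ((φ (sᶜ.card + 1)).curryLeft.compMultilinearMap (X s.card))

/-- The derivative of `φ` along the vector field `X`: on homogeneous arguments it is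
`v ↦ ∑ₛ ± φ (X (v_s), v_{sᶜ})`, the sum over all subsets `s` with Koszul signs.  It is extended
to all arguments by splitting each of them in its even and its odd part. -/
def derivAlong (𝒱 : Grading k V) (X : FormalMap k V V) (φ : FormalMap k V W) :
    FormalMap k V W := fun m =>
  ∑ p : Fin m → Bool, ∑ s : Finset (Fin m),
    koszulSign s p • (insertOne φ X s).compLinearMap fun i => 𝒱.parityProj (p i)

/-- A bilinear form as a formal map concentrated in polynomial degree two. -/
def ofBilin (B : V →ₗ[k] V →ₗ[k] k) : FormalMap k V k
  | 2 => (MultilinearMap.ofSubsingleton k V (V →ₗ[k] k) (0 : Fin 1) B).uncurryRight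
  | _ => 0

/-- The Taylor coefficients `(v₁, …, vₘ, u) ↦ ω (Q (v₁, …, vₘ), u)`. -/
def lower (ω : V →ₗ[k] V →ₗ[k] k) (Q : FormalMap k V V) : FormalMap k V k
  | 0 => 0
  | m + 1 => (ω.compMultilinearMap (Q m)).uncurryRight

/-- A degree-preserving linear map that intertwines all Taylor coefficients of two vector
fields; for cohomological vector fields, a strict map of `L∞` algebras. -/
structure IsStrictMap {V' : Type*} [AddCommGroup V'] [Module k V'] (𝒱 : Grading k V)
    (𝒱' : Grading k V') (Q : FormalMap k V V) (Q' : FormalMap k V' V') (f : V →ₗ[k] V') :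
    Prop where
  map_deg : ∀ i, ∀ x ∈ 𝒱.deg i, f x ∈ 𝒱'.deg i
  map_bracket : ∀ (m : ℕ) (v : Fin m → V), f (Q m v) = Q' m (fun i => f (v i))

end FormalMaps

/-! ### Formal moduli problems, symplectic structures, Lagrangians -/

/-- A formal moduli problem `X`, presented by an `L∞` algebra `𝔤`.  The graded space is the
tangent complex `V = 𝔤[1]` of `X` at its base point; the brackets `𝔤^{⊗m} → 𝔤[2-m]` become, by
décalage, graded symmetric maps `Q m : V^{⊗m} → V` of degree one, and the generalized Jacobi
identities `∑ₛ ± Q (Q (v_s), v_{sᶜ}) = 0` say that `Q` is a cohomological vector field. -/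
structure LInfinity {k : Type*} [Field k] {V : Type*} [AddCommGroup V] [Module k V]
    (𝒱 : Grading k V) where
  Q : FormalMap k V V
  symm : GradedSymm 𝒱 Q
  degree : FieldDegree 𝒱 1 Q
  zero : Q 0 = 0
  jacobi : ∀ m, derivAlong 𝒱 Q Q m = 0

section Geometry

variable {k : Type*} [Field k] {G : Type*} [AddCommGroup G] [Module k G]
  {T : Type*} [AddCommGroup T] [Module k T] {𝒢 : Grading k G} {𝒯 : Grading k T}

/-- A strict, constant coefficient `n`-shifted symplectic structure: a graded antisymmetric
pairing of degree `-n` on `𝔤[1]` (by décalage, a symmetric map `𝔤 → 𝔤^*[n-2]`), nondegenerate,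
and invariant: `ω (Q (v₁, …, vₘ), vₘ₊₁)` is graded symmetric in all arguments. -/
structure ShiftedSymplectic (X : LInfinity 𝒢) (n : ℤ) where
  form : G →ₗ[k] G →ₗ[k] k
  degree : ∀ a b : ℤ, a + b ≠ -n → ∀ x ∈ 𝒢.deg a, ∀ y ∈ 𝒢.deg b, form x y = 0
  antisymm : ∀ a b : ℤ, ∀ x ∈ 𝒢.deg a, ∀ y ∈ 𝒢.deg b,
    form x y = -((a * b).negOnePow • form y x)
  nondegenerate : Function.Bijective form
  invariant : GradedSymm 𝒢 (lower form X.Q)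

/-- A regular embedded Lagrangian: a strict, injective `L∞` map whose image equals its own
orthogonal complement. -/
structure IsRegularLagrangian {X : LInfinity 𝒢} {n : ℤ} (ω : ShiftedSymplectic X n)
    (L : LInfinity 𝒯) (f : T →ₗ[k] G) : Prop where
  strict : IsStrictMap 𝒯 𝒢 L.Q X.Q f
  injective : Function.Injective f
  isotropic : ∀ x y, ω.form (f x) (f y) = 0
  coisotropic : ∀ y, (∀ x, ω.form y (f x) = 0) → y ∈ LinearMap.range f

/-- `M` is a graded isotropic complement to the image of `f`. -/
structure IsIsotropicComplement {X : LInfinity 𝒢} {n : ℤ} (ω : ShiftedSymplectic X n)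
    (f : T →ₗ[k] G) (M : Submodule k G) : Prop where
  graded : M = ⨆ i, M ⊓ 𝒢.deg i
  compl : IsCompl (LinearMap.range f) M
  isotropic : ∀ x ∈ M, ∀ y ∈ M, ω.form x y = 0

end Geometry

/-! ### The shifted cotangent bundle and polyvector fields -/

section Cotangent

variable {k : Type*} [Field k] {T : Type*} [AddCommGroup T] [Module k T]

/-- The canonical `n`-shifted symplectic form on `T ⊕ T^*[n]`, namely
`ω ((x, ξ), (y, η)) = ξ y - (-1) ^ ((n + 1) * |x|) η x`. -/
def canonicalForm (𝒯 : Grading k T) (n : ℤ) :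
    (T × Module.Dual k T) →ₗ[k] (T × Module.Dual k T) →ₗ[k] k :=
  LinearMap.mk₂ k (fun e e' => e.2 e'.1 - e'.2 (𝒯.signOp (n + 1) e.1))
    (fun _ _ _ => by simp only [Prod.snd_add, Prod.fst_add, LinearMap.add_apply, map_add]; ring)
    (fun _ _ _ => by simp [mul_sub])
    (fun _ _ _ => by simp only [Prod.snd_add, Prod.fst_add, LinearMap.add_apply, map_add]; ring)
    (fun _ _ _ => by simp [mul_sub])

/-- The inverse of `canonicalForm`. -/
def sharp [FiniteDimensional k T] (𝒯 : Grading k T) (n : ℤ) :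
    Module.Dual k (T × Module.Dual k T) →ₗ[k] T × Module.Dual k T :=
  LinearMap.prod
    (-(𝒯.signOp (n + 1) ∘ₗ (Module.evalEquiv k T).symm.toLinearMap ∘ₗ
      (LinearMap.inr k T (Module.Dual k T)).dualMap))
    (LinearMap.inl k T (Module.Dual k T)).dualMap

theorem canonicalForm_sharp [FiniteDimensional k T] (𝒯 : Grading k T) (n : ℤ)
    (α : Module.Dual k (T × Module.Dual k T)) : canonicalForm 𝒯 n (sharp 𝒯 n α) = α := by
  refine LinearMap.ext fun e => ?_
  have h : ∀ η : Module.Dual k T, η ((Module.evalEquiv k T).symm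
      ((LinearMap.inr k T (Module.Dual k T)).dualMap α)) = α (0, η) := fun η => by
    rw [Module.apply_evalEquiv_symm_apply]; rfl
  obtain ⟨y, η⟩ := e
  change α (y, 0) - η (𝒯.signOp (n + 1) (-𝒯.signOp (n + 1) ((Module.evalEquiv k T).symm
    ((LinearMap.inr k T (Module.Dual k T)).dualMap α)))) = α (y, η)
  rw [map_neg, map_neg, Grading.signOp_signOp, h, sub_neg_eq_add]
  rw [← map_add]; simp

variable [FiniteDimensional k T]

/-- The Hamiltonian vector field of `F`: `ω (X_F (v₁, …, vₘ), u) = F (v₁, …, vₘ, u)`. -/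
def hamiltonian (𝒯 : Grading k T) (n : ℤ) (F : FormalMap k (T × Module.Dual k T) k) :
    FormalMap k (T × Module.Dual k T) (T × Module.Dual k T) :=
  fun m => (sharp 𝒯 n).compMultilinearMap (F (m + 1)).curryRight

/-- The Poisson bracket `{F, G} = X_F (G)` on functions on `T^*[n]L`, which is the Schouten
bracket of polyvector fields. -/
def schouten (𝒯 : Grading k T) (n : ℤ) (F H : FormalMap k (T × Module.Dual k T) k) :
    FormalMap k (T × Module.Dual k T) k :=
  derivAlong (𝒯.cotangent n) (hamiltonian 𝒯 n F) H

/-- The part of polynomial degree `j` in the fibre direction `T^*[n]`. -/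
def weightPart {W : Type*} [AddCommGroup W] [Module k W] (j : ℕ) {m : ℕ}
    (φ : MultilinearMap k (fun _ : Fin m => T × Module.Dual k T) W) :
    MultilinearMap k (fun _ : Fin m => T × Module.Dual k T) W :=
  ∑ A ∈ Finset.powersetCard j (Finset.univ : Finset (Fin m)),
    φ.compLinearMap fun i =>
      if i ∈ A then LinearMap.inr k T (Module.Dual k T) ∘ₗ LinearMap.snd k T (Module.Dual k T)
      else LinearMap.inl k T (Module.Dual k T) ∘ₗ LinearMap.fst k T (Module.Dual k T)

/-- Polyvector fields `∏_{j ≥ 2} Γ(L, Sym^j (T_L[-n]))` of cohomological degree `d`, as functions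
on `T^*[n]L` without components of fibre degree zero and one. -/
structure IsPolyvector (𝒯 : Grading k T) (n d : ℤ) (P : FormalMap k (T × Module.Dual k T) k) :
    Prop where
  symm : GradedSymm (𝒯.cotangent n) P
  degree : FunctionDegree (𝒯.cotangent n) d P
  weight_zero : ∀ m, weightPart 0 (P m) = 0
  weight_one : ∀ m, weightPart 1 (P m) = 0

/-- A vector field on `L`, viewed as a function on `T^*[n]L` linear along the fibres: the sum
`∑ᵢ ± ω ((Q (x₁, …, x̂ᵢ, …, xₘ), 0), (0, ξᵢ))`. -/
def linearFunction (𝒯 : Grading k T) (n : ℤ) (Q : FormalMap k T T) :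
    FormalMap k (T × Module.Dual k T) k :=
  derivAlong (𝒯.cotangent n)
    (fun m => (LinearMap.inl k T (Module.Dual k T)).compMultilinearMap
      ((Q m).compLinearMap fun _ => LinearMap.fst k T (Module.Dual k T)))
    (ofBilin ((canonicalForm 𝒯 n).compl₁₂
      (LinearMap.inl k T (Module.Dual k T) ∘ₗ LinearMap.fst k T (Module.Dual k T))
      (LinearMap.inr k T (Module.Dual k T) ∘ₗ LinearMap.snd k T (Module.Dual k T))))

variable {𝒯 : Grading k T}

/-- The mixed polyvector field `Q_𝔩 + P`. -/
def totalHamiltonian (L : LInfinity 𝒯) (n : ℤ) (P : FormalMap k (T × Module.Dual k T) k) :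
    FormalMap k (T × Module.Dual k T) k :=
  fun m => linearFunction 𝒯 n L.Q m + P m

/-- An `(n-1)`-shifted homotopy Poisson structure on `L`: a polyvector field `P` of degree
`n + 1` with components in `Sym^j (T_L[-n])`, `j ≥ 2`, satisfying `[Q + P, Q + P] = 0`. -/
structure IsHomotopyPoisson (L : LInfinity 𝒯) (n : ℤ)
    (P : FormalMap k (T × Module.Dual k T) k) : Prop where
  polyvector : IsPolyvector 𝒯 n (n + 1) P
  maurerCartan : ∀ m, schouten 𝒯 n (totalHamiltonian L n P) (totalHamiltonian L n P) m = 0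

/-- The vector field of the twisted cotangent bundle `T^*_P[n]L`; for `P = 0` this is the shifted
cotangent bundle `T^*[n]L` itself. -/
def twistedCotangent (L : LInfinity 𝒯) (n : ℤ) (P : FormalMap k (T × Module.Dual k T) k) :
    FormalMap k (T × Module.Dual k T) (T × Module.Dual k T) :=
  hamiltonian 𝒯 n (totalHamiltonian L n P)

/-- Gauge equivalence of homotopy Poisson structures: `Q + P' = exp [B, -] (Q + P)` for a
polyvector field `B` of degree `n`.  Bracketing with `B` raises the fibre degree and does not lower
the polynomial degree, so in polynomial degree `m` the terms with `r > m` vanish. -/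
def GaugeEquivalent (L : LInfinity 𝒯) (n : ℤ) (P P' : FormalMap k (T × Module.Dual k T) k) :
    Prop :=
  ∃ B, IsPolyvector 𝒯 n n B ∧ ∀ m, totalHamiltonian L n P' m =
    ∑ r ∈ Finset.range (m + 1),
      ((r.factorial : k)⁻¹) • ((schouten 𝒯 n B)^[r] (totalHamiltonian L n P)) m

/-- The polyvector field `∑_{j ≥ 2} c ^ (j - 1) P_j`. -/
def rescale (c : k) (P : FormalMap k (T × Module.Dual k T) k) :
    FormalMap k (T × Module.Dual k T) k :=
  fun m => ∑ j ∈ Finset.range (m + 1), c ^ (j - 1) • weightPart j (P m)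

/-- Dilation of the fibres of `T^*[n]L`. -/
def dilation (k T : Type*) [Field k] [AddCommGroup T] [Module k T] (c : k) :
    (T × Module.Dual k T) →ₗ[k] (T × Module.Dual k T) :=
  LinearMap.id.prodMap (c • LinearMap.id)

/-- Transport of polyvector fields along a linear isomorphism. -/
def pushforward {T' : Type*} [AddCommGroup T'] [Module k T'] (χ : T ≃ₗ[k] T')
    (P : FormalMap k (T × Module.Dual k T) k) : FormalMap k (T' × Module.Dual k T') k :=
  fun m => (P m).compLinearMap fun _ =>
    χ.symm.toLinearMap.prodMap χ.dualMap.toLinearMap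

variable {G : Type*} [AddCommGroup G] [Module k G] {𝒢 : Grading k G}

/-- A symplectic splitting: a graded linear symplectic isomorphism `T ⊕ T^*[n] ≅ 𝔤[1]` that
extends the embedding `f` of the zero section. -/
structure IsSplitting {X : LInfinity 𝒢} {n : ℤ} (ω : ShiftedSymplectic X n) (𝒯 : Grading k T)
    (f : T →ₗ[k] G) (Φ : (T × Module.Dual k T) ≃ₗ[k] G) : Prop where
  map_deg : ∀ i, ∀ e ∈ (𝒯.cotangent n).deg i, Φ e ∈ 𝒢.deg i
  zero_section : ∀ x, Φ (x, 0) = f x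
  symplectic : ∀ e e', ω.form (Φ e) (Φ e') = canonicalForm 𝒯 n e e'

/-- `P` is a homotopy Poisson structure on `L` and `Φ` is an isomorphism of `n`-shifted symplectic
formal moduli problems `T^*_P[n]L ≅ X` under `L`. -/
structure IsInducedPoisson {X : LInfinity 𝒢} {n : ℤ} (ω : ShiftedSymplectic X n)
    (L : LInfinity 𝒯) (f : T →ₗ[k] G) (Φ : (T × Module.Dual k T) ≃ₗ[k] G)
    (P : FormalMap k (T × Module.Dual k T) k) : Prop where
  splitting : IsSplitting ω 𝒯 f Φ
  poisson : IsHomotopyPoisson L n P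
  strict : IsStrictMap (𝒯.cotangent n) 𝒢 (twistedCotangent L n P) X.Q Φ.toLinearMap

end Cotangent

end

end FormalModuli

open FormalModuli

/-!
The bracket of `X` is encoded by the single function `H (v₁, …, vₘ, u) = ω (Q (v₁, …, vₘ), u)`, and
invariance of `ω` turns the Jacobi identities into the master equation `{H, H} = 0`. In the
coordinates of a symplectic splitting `T ⊕ T^*[n] ≅ 𝔤[1]` the Lagrangian condition says that `H` has
no component of fibre degree `0`, and strictness of `f` that its component of fibre degree `1` is
`Q_𝔩`; the remaining components are `Π`, and no other choice is possible because a Hamiltonian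
vector field determines its Hamiltonian up to a constant. Dilating the fibres by `c` multiplies the
component of fibre degree `j` by `c ^ j` and the symplectic form by `c`, which is the deformation to
the normal cone; at `c = 0` the master equation persists because it is polynomial in `c`. Finally,
two splittings differ by `id + N` where `N` maps the fibre to the base and kills the base. Then
`N ^ 2 = 0`, so `id + N = exp N` is the flow of a quadratic Hamiltonian in `Sym^2 (T_L[-n])`, the
gauge transformation.
-/

namespace FormalModuli

noncomputable section

section GradedMaps

variable {k : Type*} [Field k] {V W U : Type*} [AddCommGroup V] [Module k V]
  [AddCommGroup W] [Module k W] [AddCommGroup U] [Module k U]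
  {𝒱 : Grading k V} {𝒲 : Grading k W} {𝒰 : Grading k U}

theorem Grading.mem_iSup (𝒱 : Grading k V) (x : V) : x ∈ ⨆ i, 𝒱.deg i :=
  𝒱.internal.submodule_iSup_eq_top ▸ Submodule.mem_top

theorem Grading.multilinear_ext (𝒱 : Grading k V) {m : ℕ}
    {φ ψ : MultilinearMap k (fun _ : Fin m => V) W}
    (h : ∀ (v : Fin m → V) (a : Fin m → ℤ), (∀ i, v i ∈ 𝒱.deg (a i)) → φ v = ψ v) : φ = ψ :=
  Module.Basis.ext_multilinear
    (fun _ => 𝒱.internal.collectedBasis fun i => Module.Basis.ofVectorSpace k (𝒱.deg i))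
    fun v => h _ (fun i => (v i).1) fun i => 𝒱.internal.collectedBasis_mem _ (v i)

theorem Grading.linear_ext (𝒱 : Grading k V) {φ ψ : V →ₗ[k] W}
    (h : ∀ i, ∀ x ∈ 𝒱.deg i, φ x = ψ x) : φ = ψ := by
  refine LinearMap.ext fun x => ?_
  induction 𝒱.mem_iSup x using Submodule.iSup_induction' with
  | mem i x hx => exact h i x hx
  | zero => simp
  | add x y _ _ h₁ h₂ => simp [h₁, h₂]

theorem Grading.parityProj_of_mem (𝒱 : Grading k V) {i : ℤ} {x : V} (hx : x ∈ 𝒱.deg i)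
    (b : Bool) : 𝒱.parityProj b x = if decide (Odd i) = b then x else 0 := by
  simp only [parityProj, 𝒱.act_of_mem _ hx, ite_smul, one_smul, zero_smul]

/-- Linear maps of degree zero between graded vector spaces. -/
abbrev IsGradedMap (𝒱 : Grading k V) (𝒲 : Grading k W) (f : V →ₗ[k] W) : Prop :=
  ∀ i, ∀ x ∈ 𝒱.deg i, f x ∈ 𝒲.deg i

namespace IsGradedMap

variable {f : V →ₗ[k] W}

theorem comp {g : W →ₗ[k] U} (hg : IsGradedMap 𝒲 𝒰 g) (hf : IsGradedMap 𝒱 𝒲 f) :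
    IsGradedMap 𝒱 𝒰 (g ∘ₗ f) := fun i x hx => hg i _ (hf i x hx)

theorem map_act (hf : IsGradedMap 𝒱 𝒲 f) (c : ℤ → k) (x : V) :
    f (𝒱.act c x) = 𝒲.act c (f x) := by
  have : f ∘ₗ 𝒱.act c = 𝒲.act c ∘ₗ f := 𝒱.linear_ext fun i x hx => by
    simp only [LinearMap.comp_apply, 𝒱.act_of_mem _ hx, 𝒲.act_of_mem _ (hf i x hx), map_smul]
  exact LinearMap.congr_fun this x

end IsGradedMap

/-- The projection of a graded vector space to its component of degree `i`. -/
def Grading.proj (𝒱 : Grading k V) (i : ℤ) : V →ₗ[k] V :=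
  𝒱.act fun j => if j = i then 1 else 0

theorem Grading.proj_of_mem (𝒱 : Grading k V) {i : ℤ} {x : V} (hx : x ∈ 𝒱.deg i) :
    𝒱.proj i x = x := by
  simp [proj, 𝒱.act_of_mem _ hx]

theorem Grading.proj_of_mem_ne (𝒱 : Grading k V) {i j : ℤ} (hij : j ≠ i) {x : V}
    (hx : x ∈ 𝒱.deg j) : 𝒱.proj i x = 0 := by
  simp [proj, 𝒱.act_of_mem _ hx, hij]

theorem Grading.proj_mem_inf_of_graded (𝒱 : Grading k V) {M : Submodule k V}
    (hM : M = ⨆ i, M ⊓ 𝒱.deg i) (i : ℤ) {x : V} (hx : x ∈ M) : 𝒱.proj i x ∈ M ⊓ 𝒱.deg i := by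
  rw [hM] at hx
  induction hx using Submodule.iSup_induction' with
  | mem j x hx =>
    obtain rfl | hij := eq_or_ne j i
    · rwa [𝒱.proj_of_mem hx.2]
    · simp [𝒱.proj_of_mem_ne hij hx.2]
  | zero => simp
  | add x y _ _ h₁ h₂ => rw [map_add]; exact Submodule.add_mem _ h₁ h₂

theorem Grading.proj_mem (𝒱 : Grading k V) (i : ℤ) (x : V) : 𝒱.proj i x ∈ 𝒱.deg i :=
  (𝒱.proj_mem_inf_of_graded (M := ⊤) (by simp [𝒱.internal.submodule_iSup_eq_top]) i
    Submodule.mem_top).2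

/-- The part of degree zero of a linear map between graded vector spaces; it turns linear sections
of graded maps into graded ones. -/
def Grading.degreeZeroPart (𝒱 : Grading k V) (𝒲 : Grading k W) (s : V →ₗ[k] W) : V →ₗ[k] W :=
  DirectSum.toModule k ℤ W (fun i => 𝒲.proj i ∘ₗ s ∘ₗ (𝒱.deg i).subtype) ∘ₗ
    𝒱.decomp.symm.toLinearMap

theorem Grading.degreeZeroPart_of_mem (𝒱 : Grading k V) (𝒲 : Grading k W) (s : V →ₗ[k] W)
    {i : ℤ} {x : V} (hx : x ∈ 𝒱.deg i) : 𝒱.degreeZeroPart 𝒲 s x = 𝒲.proj i (s x) := by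
  have h : 𝒱.decomp.symm x = DirectSum.lof k ℤ (fun i => 𝒱.deg i) i ⟨x, hx⟩ := by
    rw [LinearEquiv.symm_apply_eq, decomp_lof]
  simp [degreeZeroPart, h, DirectSum.toModule_lof]

namespace IsGradedMap

variable {f : V →ₗ[k] W}

theorem map_proj (hf : IsGradedMap 𝒱 𝒲 f) (i : ℤ) (x : V) : f (𝒱.proj i x) = 𝒲.proj i (f x) :=
  hf.map_act _ x

theorem symm {e : V ≃ₗ[k] W} (he : IsGradedMap 𝒱 𝒲 e.toLinearMap) :
    IsGradedMap 𝒲 𝒱 e.symm.toLinearMap := fun i x hx => by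
  have h : 𝒱.proj i (e.symm x) = e.symm x := e.injective <| by
    simpa [𝒲.proj_of_mem hx] using he.map_proj i (e.symm x)
  exact h ▸ 𝒱.proj_mem i _

theorem exists_rightInverse (hf : IsGradedMap 𝒱 𝒲 f) (hsurj : Function.Surjective f) :
    ∃ s : W →ₗ[k] V, IsGradedMap 𝒲 𝒱 s ∧ ∀ y, f (s y) = y := by
  obtain ⟨s, hs⟩ := f.exists_rightInverse_of_surjective (LinearMap.range_eq_top.2 hsurj)
  have hs₀ := fun i y (hy : y ∈ 𝒲.deg i) => 𝒲.degreeZeroPart_of_mem 𝒱 s hy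
  refine ⟨𝒲.degreeZeroPart 𝒱 s, fun i y hy => hs₀ i y hy ▸ 𝒱.proj_mem i _, fun y => ?_⟩
  have : f ∘ₗ 𝒲.degreeZeroPart 𝒱 s = LinearMap.id := 𝒲.linear_ext fun i y hy => by
    have hsy : f (s y) = y := LinearMap.congr_fun hs y
    rw [LinearMap.comp_apply, hs₀ i y hy, hf.map_proj, hsy, 𝒲.proj_of_mem hy, LinearMap.id_apply]
  exact LinearMap.congr_fun this y

end IsGradedMap

/-- The graded vector space `V^*[n]`, the fibre direction of `Grading.cotangent`. -/
def Grading.dual [FiniteDimensional k V] (𝒱 : Grading k V) (n : ℤ) :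
    Grading k (Module.Dual k V) where
  deg := 𝒱.dualDeg n
  internal := by
    have h := (𝒱.cotangent n).internal
    rw [DirectSum.isInternal_submodule_iff_iSupIndep_and_iSup_eq_top] at h ⊢
    constructor
    · have hle : ∀ i, 𝒱.dualDeg n i ≤
          ((𝒱.cotangent n).deg i).comap (LinearMap.inr k V (Module.Dual k V)) :=
        fun i ξ hξ => ⟨Submodule.zero_mem _, hξ⟩
      refine fun i => Submodule.disjoint_def.2 fun ξ hξ hξ' => ?_
      have hsup := (iSup₂_le fun j (hj : j ≠ i) =>
        (hle j).trans (Submodule.comap_mono (le_iSup₂_of_le j hj le_rfl))) hξ'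
      simpa using Submodule.disjoint_def.1 (h.1 i) _ (hle i hξ) hsup
    · have hsnd := congrArg (Submodule.map (LinearMap.snd k V (Module.Dual k V))) h.2
      rw [Submodule.map_iSup, Submodule.map_top, Submodule.range_snd] at hsnd
      refine top_unique (hsnd ▸ iSup_mono fun i => ?_)
      rintro _ ⟨e, he, rfl⟩
      exact he.2

theorem IsGradedMap.dualMap [FiniteDimensional k V] [FiniteDimensional k W] {f : V →ₗ[k] W}
    (hf : IsGradedMap 𝒱 𝒲 f) (n : ℤ) : IsGradedMap (𝒲.dual n) (𝒱.dual n) f.dualMap :=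
  fun _ _ hξ j hj x hx => hξ j hj _ (hf j x hx)

end GradedMaps

section Lists

variable {k : Type*} [Field k] {V : Type*} [AddCommGroup V] [Module k V]
  {W : Type*} [AddCommGroup W] [Module k W] {𝒱 : Grading k V}

/-- The value of a formal map on the arguments listed in `l`: with lists of arguments, unshuffles
become concatenations. -/
def evalList (φ : FormalMap k V W) (l : List V) : W := φ l.length l.get

theorem evalList_eq (φ : FormalMap k V W) {l : List V} {m : ℕ} (h : l.length = m) {v : Fin m → V}
    (hv : ∀ i : Fin m, l[i] = v i) : evalList φ l = φ m v := by
  subst h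
  exact congrArg _ (funext hv)

theorem evalList_ofFn (φ : FormalMap k V W) {m : ℕ} (v : Fin m → V) :
    evalList φ (List.ofFn v) = φ m v :=
  evalList_eq φ (List.length_ofFn) fun i => by simp

theorem evalList_map_finRange (φ : FormalMap k V W) {m : ℕ} (v : Fin m → V) :
    evalList φ ((List.finRange m).map v) = φ m v := by
  rw [← List.ofFn_eq_map, evalList_ofFn]

theorem evalList_cons (φ : FormalMap k V W) (x : V) (l : List V) :
    evalList φ (x :: l) = (φ (l.length + 1)).curryLeft x l.get :=
  evalList_eq φ rfl fun i => by cases i using Fin.cases <;> simp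

theorem evalList_lower_append (ω : V →ₗ[k] V →ₗ[k] k) (Q : FormalMap k V V) (l : List V) (u : V) :
    evalList (lower ω Q) (l ++ [u]) = ω (evalList Q l) u := by
  rw [evalList_eq (lower ω Q) (m := l.length + 1) (v := Fin.snoc l.get u) (by simp)]
  · simp [lower, evalList]
  · intro i
    cases i using Fin.lastCases <;> simp

/-- The members of `l` are homogeneous, of the degrees listed in `a`. -/
abbrev HomogeneousList (𝒱 : Grading k V) (l : List V) (a : List ℤ) : Prop :=
  List.Forall₂ (fun x d => x ∈ 𝒱.deg d) l a

theorem HomogeneousList.map {ι : Type*} {v : ι → V} {a : ι → ℤ} (h : ∀ i, v i ∈ 𝒱.deg (a i))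
    (l : List ι) : HomogeneousList 𝒱 (l.map v) (l.map a) :=
  List.forall₂_map_left_iff.2 <| List.forall₂_map_right_iff.2 <|
    List.forall₂_same.2 fun i _ => h i

theorem FieldDegree.evalList_mem {d : ℤ} {Q : FormalMap k V V} (hQ : FieldDegree 𝒱 d Q)
    {l : List V} {a : List ℤ} (h : HomogeneousList 𝒱 l a) : evalList Q l ∈ 𝒱.deg (d + a.sum) := by
  have hlen := h.length_eq
  have hmem := hQ l.length l.get (fun i => a.get (i.cast hlen)) fun i =>
    (List.forall₂_iff_get.1 h).2 i i.2 (hlen ▸ i.2)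
  rwa [show ∑ i, a.get (Fin.cast hlen i) = a.sum from
    (Equiv.sum_comp (finCongr hlen) a.get).trans (by simp [Fin.sum_univ_getElem])] at hmem

theorem GradedSymm.evalList_swap {φ : FormalMap k V W} (hφ : GradedSymm 𝒱 φ) (l₁ l₂ : List V)
    {x y : V} {a b : ℤ} (hx : x ∈ 𝒱.deg a) (hy : y ∈ 𝒱.deg b) :
    evalList φ (l₁ ++ x :: y :: l₂) = (a * b).negOnePow • evalList φ (l₁ ++ y :: x :: l₂) := by
  have hlen : l₁.length + (l₂.length + 1 + 1) = (l₁ ++ y :: x :: l₂).length := by simp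
  let i : Fin (l₁ ++ y :: x :: l₂).length := ⟨l₁.length, by omega⟩
  let j : Fin (l₁ ++ y :: x :: l₂).length := ⟨l₁.length + 1, by omega⟩
  rw [mul_comm a b]
  refine (evalList_eq φ (by simp) fun p => ?_).trans <| hφ _ (l₁ ++ y :: x :: l₂).get i j rfl b a
    (by simpa [i] using hy) (by simpa [j] using hx)
  obtain rfl | hi := eq_or_ne p i
  · simp [i, j]
  obtain rfl | hj := eq_or_ne p j
  · simp [i, j]
  have hi' : (p : ℕ) ≠ l₁.length := fun h => hi (Fin.ext h)
  have hj' : (p : ℕ) ≠ l₁.length + 1 := fun h => hj (Fin.ext h)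
  simp only [Function.comp, Equiv.swap_apply_of_ne_of_ne hi hj, List.get_eq_getElem,
    Fin.getElem_fin, List.getElem_append]
  split_ifs
  · rfl
  · obtain ⟨q, hq⟩ : ∃ q, (p : ℕ) - l₁.length = q + 2 := ⟨p - l₁.length - 2, by omega⟩
    simp [hq]

theorem GradedSymm.evalList_append_cons {φ : FormalMap k V W} (hφ : GradedSymm 𝒱 φ)
    (l₁ l₂ : List V) {l : List V} {a : List ℤ} (hl : HomogeneousList 𝒱 l a) {y : V} {b : ℤ}
    (hy : y ∈ 𝒱.deg b) : evalList φ (l₁ ++ l ++ y :: l₂) =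
      (a.sum * b).negOnePow • evalList φ (l₁ ++ y :: (l ++ l₂)) := by
  induction hl generalizing l₁ with
  | nil => simp
  | @cons x d l a hx _ ih =>
    have ih := ih (l₁ ++ [x])
    simp only [List.append_assoc, List.cons_append, List.nil_append] at ih ⊢
    rw [ih, hφ.evalList_swap l₁ (l ++ l₂) hx hy, smul_smul, ← Int.negOnePow_add, List.sum_cons,
      ← add_mul, add_comm d]

end Lists

section Unshuffles

open Finset

/-- The exponent of the Koszul sign of the unshuffle that moves the arguments indexed by `s` in
front of the others, for arguments of degrees `a`. -/
def koszulExponent {m : ℕ} (a : Fin m → ℤ) (s : Finset (Fin m)) : ℤ :=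
  ∑ x ∈ sᶜ, ∑ y ∈ s, if x < y then a x * a y else 0

theorem koszulExponent_add_compl {m : ℕ} (a : Fin m → ℤ) (s : Finset (Fin m)) :
    koszulExponent a s + koszulExponent a sᶜ = (∑ i ∈ s, a i) * ∑ i ∈ sᶜ, a i := by
  rw [koszulExponent, koszulExponent, compl_compl, sum_comm, mul_comm, mul_comm, sum_mul_sum,
    ← sum_add_distrib]
  refine sum_congr rfl fun y hy => ?_
  rw [← sum_add_distrib]
  refine sum_congr rfl fun x hx => ?_
  obtain h | rfl | h := lt_trichotomy x y
  · simp [h, h.not_gt, mul_comm]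
  · exact absurd hy (mem_compl.1 hx)
  · simp [h, h.not_gt]

theorem koszulSign_eq_negOnePow {m : ℕ} (s : Finset (Fin m)) (a : Fin m → ℤ) :
    koszulSign s (fun i => decide (Odd (a i))) = (koszulExponent a s).negOnePow := by
  have hsign : ∀ x y, (if decide (Odd (a x)) && decide (Odd (a y)) then -1 else 1 : ℤ) =
      (a x * a y).negOnePow := fun x y => by
    rcases Int.even_or_odd (a x * a y) with h | h
    · rw [if_neg (by simpa [← Int.odd_mul] using h), Int.negOnePow_even _ h, Units.val_one]
    · rw [if_pos (by simpa [← Int.odd_mul] using h), Int.negOnePow_odd _ h, Units.val_neg,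
        Units.val_one]
  have hsum : ∀ S : Finset (Fin m × Fin m), ∏ x ∈ S, ((a x.1 * a x.2).negOnePow : ℤ) =
      (∑ x ∈ S, a x.1 * a x.2).negOnePow := fun S => by
    induction S using Finset.cons_induction with
    | empty => simp
    | cons x S hx ih => rw [prod_cons, sum_cons, ih, Int.negOnePow_add, Units.val_mul]
  simp only [koszulSign, hsign, hsum, sum_filter, sum_product, koszulExponent]

/-- A subset of `Fin m` as a subset of `Fin (m + 1)` that does not contain the last element. -/
abbrev castSuccFinset {m : ℕ} (t : Finset (Fin m)) : Finset (Fin (m + 1)) :=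
  t.map Fin.castSuccEmb

theorem compl_castSuccFinset {m : ℕ} (t : Finset (Fin m)) :
    (castSuccFinset t)ᶜ = insert (Fin.last m) (castSuccFinset tᶜ) := by
  ext i
  cases i using Fin.lastCases <;> simp

theorem compl_insert_last_castSuccFinset {m : ℕ} (t : Finset (Fin m)) :
    (insert (Fin.last m) (castSuccFinset t))ᶜ = castSuccFinset tᶜ := by
  rw [← compl_inj_iff, compl_compl, compl_castSuccFinset, compl_compl]

theorem eq_castSuccFinset_or_eq_insert_last {m : ℕ} (s : Finset (Fin (m + 1))) :
    ∃ t, s = castSuccFinset t ∨ s = insert (Fin.last m) (castSuccFinset t) := by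
  refine ⟨univ.filter fun i => i.castSucc ∈ s, ?_⟩
  by_cases h : Fin.last m ∈ s
  · right
    ext i
    cases i using Fin.lastCases <;> simp [h]
  · left
    ext i
    cases i using Fin.lastCases <;> simp [h]

theorem sum_finset_fin_succ {M : Type*} [AddCommMonoid M] {m : ℕ}
    (g : Finset (Fin (m + 1)) → M) :
    ∑ s, g s = ∑ t : Finset (Fin m), g (castSuccFinset t) +
      ∑ t : Finset (Fin m), g (insert (Fin.last m) (castSuccFinset t)) := by
  have huniv : (univ : Finset (Fin (m + 1))) =
      insert (Fin.last m) (univ.map Fin.castSuccEmb) := by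
    rw [Fin.univ_castSuccEmb, cons_eq_insert]
  have hmap : (univ.map Fin.castSuccEmb).powerset =
      (univ : Finset (Finset (Fin m))).map (mapEmbedding Fin.castSuccEmb).toEmbedding := by
    ext s
    simp [subset_map_iff, eq_comm]
  rw [← powerset_univ, huniv, sum_powerset_insert (by simp), hmap, sum_map, sum_map]
  rfl

theorem sort_castSuccFinset {m : ℕ} (t : Finset (Fin m)) :
    (castSuccFinset t).sort = t.sort.map Fin.castSucc :=
  (((Fin.strictMono_castSucc).strictMonoOn _).map_finsetSort (f := Fin.castSuccEmb)).symm

theorem sort_insert_last_castSuccFinset {m : ℕ} (t : Finset (Fin m)) :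
    (insert (Fin.last m) (castSuccFinset t)).sort = t.sort.map Fin.castSucc ++ [Fin.last m] := by
  have hs : (t.sort.map Fin.castSucc ++ [Fin.last m]).Pairwise (· ≤ ·) := by
    rw [← sort_castSuccFinset, List.pairwise_append]
    exact ⟨pairwise_sort _ _, List.pairwise_singleton _ _, fun i _ j hj =>
      List.mem_singleton.1 hj ▸ Fin.le_last i⟩
  have hnodup : (t.sort.map Fin.castSucc ++ [Fin.last m]).Nodup := by
    rw [← sort_castSuccFinset]
    exact (sort_nodup _ _).append (List.nodup_singleton _) (by simp)
  rw [← (List.toFinset_sort _ hnodup).2 hs]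
  congr 1
  ext i
  simp

theorem sum_map_sort {m : ℕ} (a : Fin m → ℤ) (s : Finset (Fin m)) :
    (s.sort.map a).sum = ∑ i ∈ s, a i :=
  ((s.sort_perm_toList _).map a).sum_eq.trans (s.sum_map_toList a)

theorem koszulExponent_castSuccFinset {m : ℕ} (a : Fin (m + 1) → ℤ) (t : Finset (Fin m)) :
    koszulExponent a (castSuccFinset t) = koszulExponent (fun i => a i.castSucc) t := by
  simp [koszulExponent, compl_castSuccFinset, not_lt.2 (Fin.le_last _)]

theorem koszulExponent_insert_last_castSuccFinset {m : ℕ} (a : Fin (m + 1) → ℤ)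
    (t : Finset (Fin m)) :
    koszulExponent a (insert (Fin.last m) (castSuccFinset t)) =
      koszulExponent (fun i => a i.castSucc) t + (∑ i ∈ tᶜ, a i.castSucc) * a (Fin.last m) := by
  rw [koszulExponent, compl_insert_last_castSuccFinset, sum_map, koszulExponent, sum_mul,
    ← sum_add_distrib]
  refine sum_congr rfl fun x _ => ?_
  rw [sum_insert (by simp), sum_map, add_comm]
  simp [Fin.castSucc_lt_last]

variable {k : Type*} [Field k] {V : Type*} [AddCommGroup V] [Module k V]
  {W : Type*} [AddCommGroup W] [Module k W] {𝒱 : Grading k V}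

theorem insertOne_apply (φ : FormalMap k V W) (X : FormalMap k V V) {m : ℕ} (s : Finset (Fin m))
    (v : Fin m → V) :
    insertOne φ X s v = evalList φ (evalList X (s.sort.map v) :: sᶜ.sort.map v) := by
  have hsort : ∀ t : Finset (Fin m),
      t.sort.map v = List.ofFn fun i => v (t.orderEmbOfFin rfl i) := fun t => by
    rw [← listMap_orderEmbOfFin_finRange t rfl, List.map_map, List.ofFn_eq_map]
    rfl
  rw [hsort, hsort, evalList_ofFn, ← List.ofFn_cons, evalList_ofFn, insertOne,
    MultilinearMap.curryFinFinset_symm_apply]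
  rfl

theorem derivAlong_apply (X : FormalMap k V V) (φ : FormalMap k V W) {m : ℕ} {v : Fin m → V}
    {a : Fin m → ℤ} (h : ∀ i, v i ∈ 𝒱.deg (a i)) :
    derivAlong 𝒱 X φ m v = ∑ s : Finset (Fin m), (koszulExponent a s).negOnePow •
      evalList φ (evalList X (s.sort.map v) :: sᶜ.sort.map v) := by
  simp only [derivAlong, _root_.sum_apply, _root_.smul_apply, MultilinearMap.compLinearMap_apply]
  rw [sum_eq_single fun i => decide (Odd (a i))]
  · simp only [𝒱.parityProj_of_mem (h _), if_true, koszulSign_eq_negOnePow, insertOne_apply,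
      Units.smul_def]
  · intro p _ hp
    obtain ⟨i, hi⟩ := Function.ne_iff.1 hp
    refine sum_eq_zero fun s _ => ?_
    rw [MultilinearMap.map_coord_zero _ i, smul_zero]
    rw [𝒱.parityProj_of_mem (h i), if_neg hi.symm]
  · simp

theorem GradedSymm.evalList_unshuffle {φ : FormalMap k V W} (hφ : GradedSymm 𝒱 φ) {m : ℕ}
    {v : Fin m → V} {a : Fin m → ℤ} (h : ∀ i, v i ∈ 𝒱.deg (a i)) (s : Finset (Fin m))
    (l : List V) :
    evalList φ ((List.finRange m).map v ++ l) = (koszulExponent a s).negOnePow •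
      evalList φ (s.sort.map v ++ sᶜ.sort.map v ++ l) := by
  induction m generalizing l with
  | zero => simp [koszulExponent, eq_empty_of_isEmpty]
  | succ m ih =>
    have hsnoc : (List.finRange (m + 1)).map v ++ l =
        (List.finRange m).map (fun i => v i.castSucc) ++ (v (Fin.last m) :: l) := by
      simp [List.finRange_succ_last, Function.comp_def]
    obtain ⟨t, rfl | rfl⟩ := eq_castSuccFinset_or_eq_insert_last s
    · rw [hsnoc, ih (fun i => h i.castSucc) t, koszulExponent_castSuccFinset,
        compl_castSuccFinset, sort_castSuccFinset, sort_insert_last_castSuccFinset]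
      simp [Function.comp_def]
    · rw [hsnoc, ih (fun i => h i.castSucc) t, koszulExponent_insert_last_castSuccFinset,
        compl_insert_last_castSuccFinset, sort_castSuccFinset, sort_insert_last_castSuccFinset,
        hφ.evalList_append_cons _ _ (HomogeneousList.map (fun i : Fin m => h i.castSucc) _)
          (h (Fin.last m)),
        sum_map_sort, smul_smul, ← Int.negOnePow_add]
      simp [Function.comp_def]

theorem GradedSymm.apply_unshuffle {φ : FormalMap k V W} (hφ : GradedSymm 𝒱 φ) {m : ℕ}
    {v : Fin m → V} {a : Fin m → ℤ} (h : ∀ i, v i ∈ 𝒱.deg (a i)) (s : Finset (Fin m)) :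
    φ m v = (koszulExponent a s).negOnePow • evalList φ (s.sort.map v ++ sᶜ.sort.map v) := by
  simpa [evalList_map_finRange] using hφ.evalList_unshuffle h s []

end Unshuffles

section Pullback

variable {k : Type*} [Field k] {V : Type*} [AddCommGroup V] [Module k V]
  {V' : Type*} [AddCommGroup V'] [Module k V'] {W : Type*} [AddCommGroup W] [Module k W]
  {𝒱 : Grading k V} {𝒱' : Grading k V'} {f : V →ₗ[k] V'}

/-- Pullback of formal maps along a linear map. -/
def pullback (f : V →ₗ[k] V') (φ : FormalMap k V' W) : FormalMap k V W :=
  fun m => (φ m).compLinearMap fun _ => f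

theorem evalList_pullback (f : V →ₗ[k] V') (φ : FormalMap k V' W) (l : List V) :
    evalList (pullback f φ) l = evalList φ (l.map f) :=
  (evalList_eq φ (by simp) fun i => by simp).symm

theorem IsStrictMap.map_evalList {X : FormalMap k V V} {X' : FormalMap k V' V'}
    (hf : IsStrictMap 𝒱 𝒱' X X' f) (l : List V) :
    f (evalList X l) = evalList X' (l.map f) :=
  (hf.map_bracket _ _).trans (evalList_eq X' (by simp) fun i => by simp).symm

theorem IsStrictMap.derivAlong_pullback {X : FormalMap k V V} {X' : FormalMap k V' V'}
    (hf : IsStrictMap 𝒱 𝒱' X X' f) (φ : FormalMap k V' W) :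
    derivAlong 𝒱 X (pullback f φ) = pullback f (derivAlong 𝒱' X' φ) := by
  funext m
  refine 𝒱.multilinear_ext fun v a h => ?_
  rw [derivAlong_apply X _ h, pullback, MultilinearMap.compLinearMap_apply,
    derivAlong_apply X' φ fun i => hf.map_deg _ _ (h i)]
  refine Finset.sum_congr rfl fun s _ => ?_
  rw [evalList_pullback, List.map_cons, hf.map_evalList, List.map_map, List.map_map]
  rfl

theorem GradedSymm.pullback (hf : IsGradedMap 𝒱 𝒱' f) {φ : FormalMap k V' W}
    (hφ : GradedSymm 𝒱' φ) : GradedSymm 𝒱 (pullback f φ) := fun m v i j hij a b hi hj =>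
  hφ m (fun i => f (v i)) i j hij a b (hf _ _ hi) (hf _ _ hj)

theorem FunctionDegree.pullback (hf : IsGradedMap 𝒱 𝒱' f) {d : ℤ} {φ : FormalMap k V' k}
    (hφ : FunctionDegree 𝒱' d φ) : FunctionDegree 𝒱 d (pullback f φ) := fun m _ a h ha =>
  hφ m _ a (fun i => hf _ _ (h i)) ha

end Pullback

section MasterEquation

variable {k : Type*} [Field k] {V : Type*} [AddCommGroup V] [Module k V] {𝒱 : Grading k V}
  {ω : V →ₗ[k] V →ₗ[k] k} {Q : FormalMap k V V}

theorem evalList_lower_evalList_append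
    (hω : ∀ a b : ℤ, ∀ x ∈ 𝒱.deg a, ∀ y ∈ 𝒱.deg b, ω x y = -((a * b).negOnePow • ω y x))
    (hQ : FieldDegree 𝒱 1 Q) (hinv : GradedSymm 𝒱 (lower ω Q)) {l₁ l₂ : List V}
    {a₁ a₂ : List ℤ} (h₁ : HomogeneousList 𝒱 l₁ a₁) (h₂ : HomogeneousList 𝒱 l₂ a₂) {u : V}
    {b : ℤ} (hu : u ∈ 𝒱.deg b) :
    evalList (lower ω Q) (evalList Q (l₁ ++ [u]) :: l₂) =
      ((a₁.sum + b) * a₂.sum).negOnePow • ω (evalList Q (evalList Q l₂ :: l₁)) u := by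
  have hQ₁ := hQ.evalList_mem (List.rel_append h₁ (.cons hu .nil))
  have hQ₂ := hQ.evalList_mem h₂
  have hmove := hinv.evalList_append_cons [] [] h₂ hQ₁
  have hmove' := hinv.evalList_append_cons [] [u] h₁ hQ₂
  rw [List.nil_append, evalList_lower_append, hω _ _ _ hQ₂ _ hQ₁, ← evalList_lower_append,
    List.append_assoc, List.singleton_append, hinv.evalList_swap _ _ hu hQ₂,
    ← List.nil_append l₁, hmove', List.nil_append, List.nil_append, List.append_nil,
    ← List.cons_append, evalList_lower_append, List.sum_append, List.sum_singleton] at hmove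
  have hneg : ∀ z : k, -z = (1 : ℤ).negOnePow • z := by simp
  simp only [hneg, smul_smul, ← Int.negOnePow_add] at hmove
  rw [← inv_smul_eq_iff, smul_smul, Int.units_inv_eq_self, ← Int.negOnePow_add] at hmove
  rw [← List.nil_append l₁, ← hmove]
  congr 1
  rw [Int.negOnePow_eq_iff]
  exact ⟨1 + a₁.sum + b + a₂.sum + a₁.sum * a₂.sum + a₂.sum * b, by ring⟩

/-- The two halves of the left side, according to whether the last argument is plugged into the
inner or into the outer vector field, agree by antisymmetry of `ω` and invariance of `Q`. -/
theorem derivAlong_lower_succ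
    (hω : ∀ a b : ℤ, ∀ x ∈ 𝒱.deg a, ∀ y ∈ 𝒱.deg b, ω x y = -((a * b).negOnePow • ω y x))
    (hQ : FieldDegree 𝒱 1 Q) (hinv : GradedSymm 𝒱 (lower ω Q)) (m : ℕ) :
    derivAlong 𝒱 Q (lower ω Q) (m + 1) = (2 : k) • lower ω (derivAlong 𝒱 Q Q) (m + 1) := by
  refine 𝒱.multilinear_ext fun v a h => ?_
  have h' : ∀ i : Fin m, v i.castSucc ∈ 𝒱.deg (a i.castSucc) := fun i => h _
  let term (t : Finset (Fin m)) : k := (koszulExponent (fun i => a i.castSucc) t).negOnePow •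
    ω (evalList Q (evalList Q (t.sort.map fun i => v i.castSucc) ::
      tᶜ.sort.map fun i => v i.castSucc)) (v (Fin.last m))
  have hlower : lower ω (derivAlong 𝒱 Q Q) (m + 1) v = ∑ t, term t := by
    change ω (derivAlong 𝒱 Q Q m fun i => v i.castSucc) (v (Fin.last m)) = _
    rw [derivAlong_apply Q Q h', map_sum, LinearMap.sum_apply]
    simp only [Units.smul_def, map_zsmul, LinearMap.smul_apply, term]
  rw [derivAlong_apply Q _ h, sum_finset_fin_succ, _root_.smul_apply, hlower, two_smul]
  congr 1
  · refine Finset.sum_congr rfl fun t _ => ?_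
    rw [koszulExponent_castSuccFinset, compl_castSuccFinset, sort_castSuccFinset,
      sort_insert_last_castSuccFinset, List.map_append, ← List.cons_append, List.map_singleton,
      evalList_lower_append, List.map_map, List.map_map]
    rfl
  · rw [← Equiv.sum_comp (compl_involutive (α := Finset (Fin m))).toPerm term]
    refine Finset.sum_congr rfl fun t _ => ?_
    rw [koszulExponent_insert_last_castSuccFinset, compl_insert_last_castSuccFinset,
      sort_castSuccFinset, sort_insert_last_castSuccFinset, List.map_append, List.map_map,
      List.map_map, List.map_singleton]
    have hterm := evalList_lower_evalList_append hω hQ hinv (HomogeneousList.map h' t.sort)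
      (HomogeneousList.map h' tᶜ.sort) (h (Fin.last m))
    refine (congrArg _ hterm).trans ?_
    simp only [Function.Involutive.coe_toPerm, term, compl_compl]
    rw [smul_smul, ← Int.negOnePow_add, sum_map_sort, sum_map_sort]
    congr 1
    rw [Int.negOnePow_eq_iff]
    have hκ := koszulExponent_add_compl (fun i => a i.castSucc) t
    exact ⟨koszulExponent (fun i => a i.castSucc) t + (∑ i ∈ tᶜ, a i.castSucc) * a (Fin.last m),
      by linear_combination -hκ⟩

theorem ShiftedSymplectic.derivAlong_lower {X : LInfinity 𝒱} {n : ℤ}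
    (ω : ShiftedSymplectic X n) : derivAlong 𝒱 X.Q (lower ω.form X.Q) = 0 := by
  funext m
  cases m with
  | zero =>
    refine 𝒱.multilinear_ext fun v a h => ?_
    have hQ : evalList X.Q [] = 0 := congrArg (fun φ => φ ([] : List V).get) X.zero
    rw [derivAlong_apply X.Q _ h]
    refine Finset.sum_eq_zero fun s _ => ?_
    rw [Finset.eq_empty_of_isEmpty s, Finset.eq_empty_of_isEmpty (∅ᶜ : Finset (Fin 0)),
      Finset.sort_empty, List.map_nil, evalList_cons, hQ, map_zero]
    exact smul_zero _
  | succ m =>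
    rw [derivAlong_lower_succ ω.antisymm X.degree ω.invariant, lower, X.jacobi]
    ext v
    simp

end MasterEquation

section Splittings

variable {k : Type*} [Field k] {G : Type*} [AddCommGroup G] [Module k G] {𝒢 : Grading k G}
  {T : Type*} [AddCommGroup T] [Module k T] {𝒯 : Grading k T}
  {X : LInfinity 𝒢} {n : ℤ} {ω : ShiftedSymplectic X n} {L : LInfinity 𝒯} {f : T →ₗ[k] G}

theorem negOnePow_mul_of_add_eq_neg {a b n : ℤ} (h : a + b = -n) :
    (a * b).negOnePow = ((n + 1) * a).negOnePow := by
  obtain rfl : b = -n - a := by omega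
  rw [Int.negOnePow_eq_iff, show a * (-n - a) - (n + 1) * a = -(a * (a + 1) + 2 * (n * a)) by ring]
  exact ((Int.even_mul_succ_self a).add (even_two_mul _)).neg

theorem ShiftedSymplectic.form_eq_neg_signOp (ω : ShiftedSymplectic X n) (x y : G) :
    ω.form x y = -ω.form y (𝒢.signOp (n + 1) x) := by
  have : ω.form = -(ω.form.flip ∘ₗ 𝒢.signOp (n + 1)) :=
    𝒢.linear_ext fun a x hx => 𝒢.linear_ext fun b y hy => by
      simp only [LinearMap.neg_apply, LinearMap.comp_apply, Grading.signOp, 𝒢.act_of_mem _ hx,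
        map_smul, LinearMap.smul_apply, LinearMap.flip_apply, smul_eq_mul]
      by_cases hab : a + b = -n
      · rw [ω.antisymm a b x hx y hy, negOnePow_mul_of_add_eq_neg hab, Units.smul_def,
          zsmul_eq_mul]
      · rw [ω.degree a b hab x hx y hy, ω.degree b a (by omega) y hy x hx, mul_zero, neg_zero]
  exact LinearMap.congr_fun (LinearMap.congr_fun this x) y

/-- The map `w ↦ ω (w, f -)` from `f^* T_X` to `L_L[n]`; its kernel is the tangent space of the
Lagrangian. -/
def restrictForm (ω : ShiftedSymplectic X n) (f : T →ₗ[k] G) : G →ₗ[k] Module.Dual k T :=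
  f.dualMap ∘ₗ ω.form

@[simp]
theorem restrictForm_apply (f : T →ₗ[k] G) (w : G) (x : T) :
    restrictForm ω f w x = ω.form w (f x) := rfl

theorem isGradedMap_restrictForm [FiniteDimensional k T] (ω : ShiftedSymplectic X n)
    (hf : IsGradedMap 𝒯 𝒢 f) : IsGradedMap 𝒢 (𝒯.dual n) (restrictForm ω f) :=
  fun i w hw j hj x hx => ω.degree i j (by omega) w hw _ (hf j x hx)

namespace IsRegularLagrangian

theorem restrictForm_eq_zero (hf : IsRegularLagrangian ω L f) (w : G) :
    restrictForm ω f w = 0 ↔ w ∈ LinearMap.range f := by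
  refine ⟨fun h => hf.coisotropic w fun x => LinearMap.congr_fun h x, ?_⟩
  rintro ⟨x, rfl⟩
  exact LinearMap.ext fun y => hf.isotropic x y

theorem restrictForm_map (hf : IsRegularLagrangian ω L f) (x : T) : restrictForm ω f (f x) = 0 :=
  (hf.restrictForm_eq_zero _).2 ⟨x, rfl⟩

theorem restrictForm_surjective (hf : IsRegularLagrangian ω L f) :
    Function.Surjective (restrictForm ω f) :=
  (LinearMap.dualMap_surjective_of_injective hf.injective).comp ω.nondegenerate.2

theorem sub_mem_range (hf : IsRegularLagrangian ω L f) {w w' : G}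
    (h : restrictForm ω f w = restrictForm ω f w') : w - w' ∈ LinearMap.range f :=
  (hf.restrictForm_eq_zero _).1 (by rw [map_sub, h, sub_self])

end IsRegularLagrangian

theorem IsIsotropicComplement.bijective_restrictForm {M : Submodule k G}
    (hM : IsIsotropicComplement ω f M) (hf : IsRegularLagrangian ω L f) :
    Function.Bijective (restrictForm ω f ∘ₗ M.subtype) := by
  constructor
  · refine fun w w' h => Subtype.ext (sub_eq_zero.1 ?_)
    exact Submodule.disjoint_def.1 hM.compl.disjoint _ (hf.sub_mem_range h) (w - w').2
  · intro ξ
    obtain ⟨w, rfl⟩ := hf.restrictForm_surjective ξ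
    obtain ⟨x, hx, y, hy, rfl⟩ := Submodule.mem_sup.1 (hM.compl.sup_eq_top ▸ Submodule.mem_top :
      w ∈ LinearMap.range f ⊔ M)
    exact ⟨⟨y, hy⟩, by simp [(hf.restrictForm_eq_zero x).2 hx]⟩

variable {σ : Module.Dual k T →ₗ[k] G}

/-- The map `ζ` with `ω (ζ ξ, w) = ω (σ ξ, σ (ω (w, f -)))`, which measures how far the image of
the section `σ` is from being isotropic. -/
def isotropyDefect (ω : ShiftedSymplectic X n) (f : T →ₗ[k] G) (σ : Module.Dual k T →ₗ[k] G) :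
    Module.Dual k T →ₗ[k] G :=
  (LinearEquiv.ofBijective ω.form ω.nondegenerate).symm.toLinearMap ∘ₗ
    (σ ∘ₗ restrictForm ω f).dualMap ∘ₗ ω.form ∘ₗ σ

theorem form_isotropyDefect (ξ : Module.Dual k T) (w : G) :
    ω.form (isotropyDefect ω f σ ξ) w = ω.form (σ ξ) (σ (restrictForm ω f w)) :=
  LinearMap.congr_fun ((LinearEquiv.ofBijective ω.form ω.nondegenerate).apply_symm_apply
    ((σ ∘ₗ restrictForm ω f).dualMap (ω.form (σ ξ)))) w

variable [FiniteDimensional k T]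

/-- A degree-preserving isotropic section of the map `w ↦ ω (w, f -)`. -/
structure IsIsotropicSection (ω : ShiftedSymplectic X n) (𝒯 : Grading k T) (f : T →ₗ[k] G)
    (σ : Module.Dual k T →ₗ[k] G) : Prop where
  isGradedMap : IsGradedMap (𝒯.dual n) 𝒢 σ
  restrictForm_apply : ∀ ξ, restrictForm ω f (σ ξ) = ξ
  isotropic : ∀ ξ η, ω.form (σ ξ) (σ η) = 0

section Existence

theorem form_apply_isotropyDefect (hσ : IsGradedMap (𝒯.dual n) 𝒢 σ)
    (hσ' : ∀ ξ, restrictForm ω f (σ ξ) = ξ) (ξ η : Module.Dual k T) :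
    ω.form (σ ξ) (isotropyDefect ω f σ η) = ω.form (σ ξ) (σ η) := by
  have hsign : σ (restrictForm ω f (𝒢.signOp (n + 1) (σ ξ))) = 𝒢.signOp (n + 1) (σ ξ) := by
    simp only [Grading.signOp, ← hσ.map_act, hσ']
  rw [ω.form_eq_neg_signOp, form_isotropyDefect, hsign, ← ω.form_eq_neg_signOp]

variable [FiniteDimensional k G]

theorem isGradedMap_isotropyDefect (hf : IsGradedMap 𝒯 𝒢 f) (hσ : IsGradedMap (𝒯.dual n) 𝒢 σ) :
    IsGradedMap (𝒯.dual n) 𝒢 (isotropyDefect ω f σ) := by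
  have hform : IsGradedMap 𝒢 (𝒢.dual n) ω.form :=
    isGradedMap_restrictForm ω (f := LinearMap.id) fun _ _ hx => hx
  have hform' : IsGradedMap 𝒢 (𝒢.dual n)
    (LinearEquiv.ofBijective ω.form ω.nondegenerate).toLinearMap := hform
  exact hform'.symm.comp
    (((hσ.comp (isGradedMap_restrictForm ω hf)).dualMap n).comp (hform.comp hσ))

/-- Subtracting half of the defect of any graded section makes it isotropic, because the defect
takes values in the isotropic subspace `range f`. -/
theorem IsRegularLagrangian.exists_isotropicSection [NeZero (2 : k)]
    (hf : IsRegularLagrangian ω L f) : ∃ σ, IsIsotropicSection ω 𝒯 f σ := by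
  obtain ⟨σ, hσ, hσ'⟩ := (isGradedMap_restrictForm ω hf.strict.map_deg).exists_rightInverse
    hf.restrictForm_surjective
  have hζ : ∀ ξ, restrictForm ω f (isotropyDefect ω f σ ξ) = 0 := fun ξ =>
    LinearMap.ext fun x => by
      rw [restrictForm_apply, form_isotropyDefect, hf.restrictForm_map, map_zero, map_zero,
        LinearMap.zero_apply]
  refine ⟨σ - (2 : k)⁻¹ • isotropyDefect ω f σ, fun i ξ hξ => ?_, fun ξ => ?_, fun ξ η => ?_⟩
  · exact Submodule.sub_mem _ (hσ i ξ hξ) <|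
      Submodule.smul_mem _ _ (isGradedMap_isotropyDefect hf.strict.map_deg hσ i ξ hξ)
  · rw [LinearMap.sub_apply, LinearMap.smul_apply, map_sub, map_smul, hσ', hζ, smul_zero, sub_zero]
  · simp only [LinearMap.sub_apply, LinearMap.smul_apply, map_sub, map_smul, form_isotropyDefect,
      form_apply_isotropyDefect hσ hσ', hσ', hζ, map_zero, smul_eq_mul]
    linear_combination -ω.form (σ ξ) (σ η) * mul_inv_cancel₀ (two_ne_zero (α := k))

end Existence

namespace IsIsotropicSection

theorem form_map_apply (hσ : IsIsotropicSection ω 𝒯 f σ) (hf : IsGradedMap 𝒯 𝒢 f) (x : T)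
    (η : Module.Dual k T) : ω.form (f x) (σ η) = -η (𝒯.signOp (n + 1) x) := by
  rw [ω.form_eq_neg_signOp, Grading.signOp, ← hf.map_act, ← FormalModuli.restrictForm_apply,
    hσ.restrictForm_apply, Grading.signOp]

theorem bijective_coprod (hσ : IsIsotropicSection ω 𝒯 f σ) (hf : IsRegularLagrangian ω L f) :
    Function.Bijective (f.coprod σ) := by
  constructor
  · rw [injective_iff_map_eq_zero]
    rintro ⟨x, ξ⟩ h
    rw [LinearMap.coprod_apply] at h
    obtain rfl : ξ = 0 := by
      simpa [hf.restrictForm_map, hσ.restrictForm_apply] using congrArg (restrictForm ω f) h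
    obtain rfl : x = 0 := (injective_iff_map_eq_zero f).1 hf.injective x (by simpa using h)
    rfl
  · intro w
    obtain ⟨x, hx⟩ := hf.sub_mem_range (hσ.restrictForm_apply (restrictForm ω f w)).symm
    exact ⟨(x, restrictForm ω f w), by simp [hx]⟩

theorem exists_splitting (hσ : IsIsotropicSection ω 𝒯 f σ) (hf : IsRegularLagrangian ω L f) :
    ∃ Φ : (T × Module.Dual k T) ≃ₗ[k] G, IsSplitting ω 𝒯 f Φ ∧ ∀ ξ, Φ (0, ξ) = σ ξ := by
  refine ⟨LinearEquiv.ofBijective _ (hσ.bijective_coprod hf), ⟨?_, fun x => by simp, ?_⟩,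
    fun ξ => by simp⟩
  · rintro i ⟨x, ξ⟩ ⟨hx, hξ⟩
    exact Submodule.add_mem _ (hf.strict.map_deg i x hx) (hσ.isGradedMap i ξ hξ)
  · rintro ⟨x, ξ⟩ ⟨y, η⟩
    have hξy : ω.form (σ ξ) (f y) = ξ y := LinearMap.congr_fun (hσ.restrictForm_apply ξ) y
    simp only [LinearEquiv.ofBijective_apply, LinearMap.coprod_apply, map_add,
      LinearMap.add_apply, hf.isotropic, hσ.isotropic, hσ.form_map_apply hf.strict.map_deg, hξy,
      canonicalForm, LinearMap.mk₂_apply]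
    ring

theorem isIsotropicComplement_range (hσ : IsIsotropicSection ω 𝒯 f σ)
    (hf : IsRegularLagrangian ω L f) : IsIsotropicComplement ω f (LinearMap.range σ) where
  graded := by
    refine le_antisymm ?_ (iSup_le fun i => inf_le_left)
    have hle : ⨆ i, (𝒯.dual n).deg i ≤ (⨆ i, LinearMap.range σ ⊓ 𝒢.deg i).comap σ :=
      iSup_le fun i ξ hξ => Submodule.mem_iSup_of_mem i ⟨⟨ξ, rfl⟩, hσ.isGradedMap i ξ hξ⟩
    rintro _ ⟨ξ, rfl⟩
    exact hle ((𝒯.dual n).mem_iSup ξ)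
  compl := by
    constructor
    · rw [Submodule.disjoint_def]
      rintro _ hx ⟨ξ, rfl⟩
      rw [← hσ.restrictForm_apply ξ, (hf.restrictForm_eq_zero _).2 hx, map_zero]
    · refine codisjoint_iff.2 (Submodule.eq_top_iff'.2 fun w => ?_)
      have hw := hf.sub_mem_range (hσ.restrictForm_apply (restrictForm ω f w)).symm
      simpa using Submodule.add_mem_sup hw (LinearMap.mem_range_self σ (restrictForm ω f w))
  isotropic := by
    rintro _ ⟨ξ, rfl⟩ _ ⟨η, rfl⟩
    exact hσ.isotropic ξ η

end IsIsotropicSection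

theorem IsSplitting.restrictForm_inr {Φ : (T × Module.Dual k T) ≃ₗ[k] G}
    (hΦ : IsSplitting ω 𝒯 f Φ) (ξ : Module.Dual k T) : restrictForm ω f (Φ (0, ξ)) = ξ :=
  LinearMap.ext fun y => by
    rw [restrictForm_apply, ← hΦ.zero_section, hΦ.symplectic]
    simp [canonicalForm]

namespace IsIsotropicComplement

variable {M : Submodule k G}

theorem exists_isotropicSection (hM : IsIsotropicComplement ω f M)
    (hf : IsRegularLagrangian ω L f) :
    ∃ σ, IsIsotropicSection ω 𝒯 f σ ∧ ∀ ξ, σ ξ ∈ M := by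
  let e := LinearEquiv.ofBijective _ (hM.bijective_restrictForm hf)
  have he : ∀ ξ, restrictForm ω f (e.symm ξ) = ξ := e.apply_symm_apply
  refine ⟨M.subtype ∘ₗ e.symm.toLinearMap, ⟨fun i ξ hξ => ?_, he, fun ξ η =>
    hM.isotropic _ (e.symm ξ).2 _ (e.symm η).2⟩, fun ξ => (e.symm ξ).2⟩
  have hproj := 𝒢.proj_mem_inf_of_graded hM.graded i (e.symm ξ).2
  have hfix : (⟨𝒢.proj i (e.symm ξ), hproj.1⟩ : M) = e.symm ξ := e.injective <| by
    refine ((isGradedMap_restrictForm ω hf.strict.map_deg).map_proj i _).trans ?_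
    rw [he, (𝒯.dual n).proj_of_mem hξ, e.apply_symm_apply]
  exact Set.mem_of_eq_of_mem (congrArg Subtype.val hfix).symm hproj.2

theorem existsUnique_splitting (hM : IsIsotropicComplement ω f M)
    (hf : IsRegularLagrangian ω L f) :
    ∃! Φ : (T × Module.Dual k T) ≃ₗ[k] G, IsSplitting ω 𝒯 f Φ ∧ ∀ ξ, Φ (0, ξ) ∈ M := by
  obtain ⟨σ, hσ, hσM⟩ := hM.exists_isotropicSection hf
  obtain ⟨Φ, hΦ, hΦσ⟩ := hσ.exists_splitting hf
  refine ⟨Φ, ⟨hΦ, fun ξ => hΦσ ξ ▸ hσM ξ⟩, fun Φ' hΦ' => ?_⟩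
  have hinr : ∀ ξ, Φ' (0, ξ) = Φ (0, ξ) := fun ξ => by
    rw [hΦσ]
    refine congrArg Subtype.val <| (hM.bijective_restrictForm hf).1
      (a₁ := ⟨_, hΦ'.2 ξ⟩) (a₂ := ⟨_, hσM ξ⟩) ?_
    exact (hΦ'.1.restrictForm_inr ξ).trans (hσ.restrictForm_apply ξ).symm
  exact LinearEquiv.toLinearMap_injective <| LinearMap.prod_ext
    (LinearMap.ext fun x => (hΦ'.1.zero_section x).trans (hΦ.zero_section x).symm)
    (LinearMap.ext hinr)

end IsIsotropicComplement

end Splittings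

section Distribute

variable {k : Type*} [Field k] {V : Type*} [AddCommGroup V] [Module k V]
  {V' : Type*} [AddCommGroup V'] [Module k V'] {W : Type*} [AddCommGroup W] [Module k W]
  {𝒱 : Grading k V} {𝒱' : Grading k V'}

/-- The sum over all ways to apply `g` to `j` of the arguments and `h` to the others. With the
projections to fibre and base this is `weightPart j`; with `N` and the identity it is the part of
degree `j` in `N` of the pullback along `id + N`. -/
def distribute (g h : V →ₗ[k] V') (j : ℕ) {m : ℕ} :
    MultilinearMap k (fun _ : Fin m => V') W →ₗ[k] MultilinearMap k (fun _ : Fin m => V) W :=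
  ∑ A ∈ Finset.powersetCard j Finset.univ,
    MultilinearMap.compLinearMapₗ fun i => if i ∈ A then g else h

theorem distribute_apply (g h : V →ₗ[k] V') (j : ℕ) {m : ℕ}
    (φ : MultilinearMap k (fun _ : Fin m => V') W) (v : Fin m → V) :
    distribute g h j φ v = ∑ A ∈ Finset.powersetCard j Finset.univ,
      φ fun i => if i ∈ A then g (v i) else h (v i) := by
  simp only [distribute, LinearMap.sum_apply, MultilinearMap.compLinearMapₗ_apply,
    sum_apply, MultilinearMap.compLinearMap_apply, apply_ite DFunLike.coe, ite_apply]

theorem distribute_one_apply (g h : V →ₗ[k] V') {m : ℕ}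
    (φ : MultilinearMap k (fun _ : Fin m => V') W) (v : Fin m → V) :
    distribute g h 1 φ v = ∑ i, φ fun j => if j = i then g (v j) else h (v j) := by
  simp [distribute_apply, Finset.powersetCard_one]

theorem distribute_of_lt (g h : V →ₗ[k] V') {j m : ℕ} (hj : m < j)
    (φ : MultilinearMap k (fun _ : Fin m => V') W) : distribute g h j φ = 0 := by
  rw [distribute, Finset.powersetCard_eq_empty.2 (by simpa using hj), Finset.sum_empty,
    LinearMap.zero_apply]

theorem compLinearMap_add_smul (g h : V →ₗ[k] V') (c : k) {m : ℕ}
    (φ : MultilinearMap k (fun _ : Fin m => V') W) :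
    φ.compLinearMap (fun _ => h + c • g) =
      ∑ j ∈ Finset.range (m + 1), c ^ j • distribute g h j φ := by
  ext v
  have hadd : (fun i => (h + c • g) (v i)) = (fun i => c • g (v i)) + fun i => h (v i) :=
    funext fun i => add_comm _ _
  have hpiecewise : ∀ A : Finset (Fin m),
      A.piecewise (fun i => c • g (v i)) (fun i => h (v i)) =
        A.piecewise (fun i => c • if i ∈ A then g (v i) else h (v i))
          fun i => if i ∈ A then g (v i) else h (v i) := fun A => by
    ext i
    by_cases hi : i ∈ A <;> simp [hi]
  rw [MultilinearMap.compLinearMap_apply, hadd, φ.map_add_univ, ← Finset.powerset_univ,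
    Finset.sum_powerset, Finset.card_univ, Fintype.card_fin]
  simp only [sum_apply, smul_apply, distribute_apply, Finset.smul_sum]
  refine Finset.sum_congr rfl fun j _ => Finset.sum_congr rfl fun A hA => ?_
  rw [hpiecewise, φ.map_piecewise_smul, Finset.prod_const, (Finset.mem_powersetCard.1 hA).2]

theorem GradedSymm.distribute {g h : V →ₗ[k] V'} (hg : IsGradedMap 𝒱 𝒱' g)
    (hh : IsGradedMap 𝒱 𝒱' h) {φ : FormalMap k V' W} (hφ : GradedSymm 𝒱' φ) (r : ℕ) :
    GradedSymm 𝒱 fun m => distribute g h r (φ m) := by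
  intro m v i j hij a b hi hj
  have hmem (p : Prop) [Decidable p] {x : V} {l : ℤ} (hx : x ∈ 𝒱.deg l) :
      (if p then g x else h x) ∈ 𝒱'.deg l := by
    split_ifs
    exacts [hg l x hx, hh l x hx]
  simp only [distribute_apply, Finset.smul_sum]
  refine Finset.sum_equiv (Equiv.swap i j).finsetCongr (by simp) fun A _ => ?_
  rw [← hφ m _ i j hij a b (hmem _ hi) (hmem _ hj)]
  exact congrArg (φ m) (funext fun l => by simp [Finset.mem_map_equiv])

theorem FunctionDegree.distribute {g h : V →ₗ[k] V'} (hg : IsGradedMap 𝒱 𝒱' g)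
    (hh : IsGradedMap 𝒱 𝒱' h) {d : ℤ} {φ : FormalMap k V' k} (hφ : FunctionDegree 𝒱' d φ)
    (r : ℕ) : FunctionDegree 𝒱 d fun m => distribute g h r (φ m) := by
  intro m v a hv ha
  simp only [distribute_apply]
  refine Finset.sum_eq_zero fun A _ => hφ m _ a (fun i => ?_) ha
  split_ifs
  exacts [hg _ _ (hv i), hh _ _ (hv i)]

theorem sum_insert_powersetCard_erase {ι M : Type*} [DecidableEq ι] [AddCommMonoid M]
    (s : Finset ι) (r : ℕ) (F : Finset ι → M) :
    ∑ i ∈ s, ∑ A ∈ Finset.powersetCard r (s.erase i), F (insert i A) =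
      (r + 1) • ∑ S ∈ Finset.powersetCard (r + 1) s, F S := by
  have hcard : ∀ S ∈ Finset.powersetCard (r + 1) s, (r + 1) • F S = ∑ _i ∈ S, F S :=
    fun S hS => by rw [Finset.sum_const, (Finset.mem_powersetCard.1 hS).2]
  rw [Finset.smul_sum, Finset.sum_congr rfl hcard, Finset.sum_sigma', Finset.sum_sigma']
  refine Finset.sum_bij' (fun p _ => ⟨insert p.1 p.2, p.1⟩) (fun p _ => ⟨p.2, p.1.erase p.2⟩)
    ?_ ?_ ?_ ?_ fun _ _ => rfl
  · rintro ⟨i, A⟩ h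
    simp only [Finset.mem_sigma, Finset.mem_powersetCard, Finset.subset_erase] at h
    simp [Finset.insert_subset_iff, h]
  · rintro ⟨S, i⟩ h
    simp only [Finset.mem_sigma, Finset.mem_powersetCard] at h
    simp [Finset.card_erase_of_mem h.2, Finset.erase_subset_erase i h.1.1, h.1.1 h.2, h.1.2]
  · rintro ⟨i, A⟩ h
    simp only [Finset.mem_sigma, Finset.mem_powersetCard, Finset.subset_erase] at h
    simp [Finset.erase_insert h.2.1.2]
  · rintro ⟨S, i⟩ h
    simp [Finset.insert_erase (Finset.mem_sigma.1 h).2]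

theorem distribute_one_distribute {N : V →ₗ[k] V} (hN : ∀ x, N (N x) = 0) (r : ℕ) {m : ℕ}
    (φ : MultilinearMap k (fun _ : Fin m => V) W) :
    distribute N LinearMap.id 1 (distribute N LinearMap.id r φ) =
      (r + 1) • distribute N LinearMap.id (r + 1) φ := by
  ext v
  let F (S : Finset (Fin m)) : W := φ fun i => if i ∈ S then N (v i) else v i
  have hfirst : ∀ i : Fin m, distribute N LinearMap.id r φ
      (fun j => if j = i then N (v j) else v j) =
        ∑ A ∈ Finset.powersetCard r (Finset.univ.erase i), F (insert i A) := by
    intro i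
    rw [distribute_apply, ← Finset.sum_subset
      (Finset.powersetCard_mono (Finset.erase_subset i Finset.univ))]
    · refine Finset.sum_congr rfl fun A hA => congrArg φ (funext fun j => ?_)
      have hi : i ∉ A := (Finset.subset_erase.1 (Finset.mem_powersetCard.1 hA).1).2
      obtain rfl | hj := eq_or_ne j i <;> simp [*]
    · intro A hA hA'
      have hi : i ∈ A := by
        by_contra hi
        exact hA' <| Finset.mem_powersetCard.2
          ⟨Finset.subset_erase.2 ⟨Finset.subset_univ A, hi⟩, (Finset.mem_powersetCard.1 hA).2⟩
      exact φ.map_coord_zero i (by simp [hi, hN])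
  calc distribute N LinearMap.id 1 (distribute N LinearMap.id r φ) v
      = ∑ i, ∑ A ∈ Finset.powersetCard r (Finset.univ.erase i), F (insert i A) := by
        rw [distribute_one_apply]
        exact Finset.sum_congr rfl fun i _ => hfirst i
    _ = (r + 1) • ∑ S ∈ Finset.powersetCard (r + 1) Finset.univ, F S :=
        sum_insert_powersetCard_erase _ _ _
    _ = ((r + 1) • distribute N LinearMap.id (r + 1) φ) v := by
        rw [smul_apply, distribute_apply]
        rfl

end Distribute

section FibreDegree

variable {k : Type*} [Field k] {T : Type*} [AddCommGroup T] [Module k T]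
  {W : Type*} [AddCommGroup W] [Module k W]

/-- Replace the arguments indexed by `A` by their fibre components and the others by their base
components. -/
def splitArgs {m : ℕ} (A : Finset (Fin m)) (e : Fin m → T × Module.Dual k T) :
    Fin m → T × Module.Dual k T :=
  fun i => if i ∈ A then (0, (e i).2) else ((e i).1, 0)

theorem weightPart_eq_distribute (j : ℕ) {m : ℕ}
    (φ : MultilinearMap k (fun _ : Fin m => T × Module.Dual k T) W) :
    weightPart j φ =
      distribute (LinearMap.inr k T (Module.Dual k T) ∘ₗ LinearMap.snd k T (Module.Dual k T))
        (LinearMap.inl k T (Module.Dual k T) ∘ₗ LinearMap.fst k T (Module.Dual k T)) j φ := by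
  simp only [weightPart, distribute, LinearMap.sum_apply, MultilinearMap.compLinearMapₗ_apply]

theorem weightPart_apply (j : ℕ) {m : ℕ}
    (φ : MultilinearMap k (fun _ : Fin m => T × Module.Dual k T) W)
    (e : Fin m → T × Module.Dual k T) :
    weightPart j φ e = ∑ A ∈ Finset.powersetCard j Finset.univ, φ (splitArgs A e) := by
  rw [weightPart_eq_distribute, distribute_apply]
  rfl

theorem weightPart_one_apply {m : ℕ}
    (φ : MultilinearMap k (fun _ : Fin m => T × Module.Dual k T) W)
    (e : Fin m → T × Module.Dual k T) : weightPart 1 φ e = ∑ i, φ (splitArgs {i} e) := by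
  simp [weightPart_apply, Finset.powersetCard_one]

theorem weightPart_sub (j : ℕ) {m : ℕ}
    (φ ψ : MultilinearMap k (fun _ : Fin m => T × Module.Dual k T) W) :
    weightPart j (φ - ψ) = weightPart j φ - weightPart j ψ := by
  simp only [weightPart_eq_distribute, map_sub]

theorem weightPart_splitArgs (j : ℕ) {m : ℕ}
    (φ : MultilinearMap k (fun _ : Fin m => T × Module.Dual k T) W) (A : Finset (Fin m))
    (e : Fin m → T × Module.Dual k T) :
    weightPart j φ (splitArgs A e) = if A.card = j then φ (splitArgs A e) else 0 := by
  have hself : splitArgs A (splitArgs A e) = splitArgs A e := by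
    ext1 i
    by_cases hi : i ∈ A <;> simp [splitArgs, hi]
  have hne : ∀ B, B ≠ A → φ (splitArgs B (splitArgs A e)) = 0 := fun B hB => by
    obtain ⟨i, hi⟩ : ∃ i, ¬(i ∈ B ↔ i ∈ A) := by
      by_contra! h
      exact hB (Finset.ext h)
    refine φ.map_coord_zero i ?_
    by_cases hiB : i ∈ B <;> by_cases hiA : i ∈ A <;> simp_all [splitArgs]
  rw [weightPart_apply]
  split_ifs with h
  · rw [Finset.sum_eq_single A (fun B _ hB => hne B hB) (by simp [h]), hself]
  · refine Finset.sum_eq_zero fun B hB => hne B ?_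
    rintro rfl
    exact h (Finset.mem_powersetCard.1 hB).2

theorem weightPart_weightPart (i j : ℕ) {m : ℕ}
    (φ : MultilinearMap k (fun _ : Fin m => T × Module.Dual k T) W) :
    weightPart i (weightPart j φ) = if i = j then weightPart j φ else 0 := by
  ext e
  have hcard : ∀ A ∈ Finset.powersetCard i (Finset.univ : Finset (Fin m)),
      weightPart j φ (splitArgs A e) = if i = j then φ (splitArgs A e) else 0 := fun A hA => by
    rw [weightPart_splitArgs, (Finset.mem_powersetCard.1 hA).2]
  rw [weightPart_apply, Finset.sum_congr rfl hcard]
  split_ifs with h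
  · rw [← h, weightPart_apply]
  · simp

theorem weightPart_eq_zero {j m : ℕ}
    {φ : MultilinearMap k (fun _ : Fin m => T × Module.Dual k T) W}
    (h : ∀ A, A.card = j → ∀ e, φ (splitArgs A e) = 0) : weightPart j φ = 0 := by
  ext e
  rw [weightPart_apply]
  exact Finset.sum_eq_zero fun A hA => h A (Finset.mem_powersetCard.1 hA).2 e

theorem compLinearMap_dilation (c : k) {m : ℕ}
    (φ : MultilinearMap k (fun _ : Fin m => T × Module.Dual k T) W) :
    φ.compLinearMap (fun _ => dilation k T c) =
      ∑ j ∈ Finset.range (m + 1), c ^ j • weightPart j φ := by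
  have hdilation : dilation k T c =
      LinearMap.inl k T (Module.Dual k T) ∘ₗ LinearMap.fst k T (Module.Dual k T) +
        c • LinearMap.inr k T (Module.Dual k T) ∘ₗ LinearMap.snd k T (Module.Dual k T) := by
    ext <;> simp [dilation]
  simp only [weightPart_eq_distribute, ← compLinearMap_add_smul, hdilation]

theorem sum_weightPart {m : ℕ} (φ : MultilinearMap k (fun _ : Fin m => T × Module.Dual k T) W) :
    ∑ j ∈ Finset.range (m + 1), weightPart j φ = φ := by
  have h := compLinearMap_dilation 1 φ
  simp only [one_pow, one_smul] at h
  rw [← h]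
  ext e
  simp [dilation]

theorem weightPart_compLinearMap {T' : Type*} [AddCommGroup T'] [Module k T'] (p : T' →ₗ[k] T)
    (q : Module.Dual k T' →ₗ[k] Module.Dual k T) (j : ℕ) {m : ℕ}
    (φ : MultilinearMap k (fun _ : Fin m => T × Module.Dual k T) W) :
    weightPart j (φ.compLinearMap fun _ => p.prodMap q) =
      (weightPart j φ).compLinearMap fun _ => p.prodMap q := by
  ext e
  simp only [MultilinearMap.compLinearMap_apply, weightPart_apply]
  refine Finset.sum_congr rfl fun A _ => congrArg φ (funext fun i => ?_)
  simp only [splitArgs]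
  split_ifs <;> simp

variable [FiniteDimensional k T] {𝒯 : Grading k T} {n : ℤ}

theorem isGradedMap_inl_fst : IsGradedMap (𝒯.cotangent n) (𝒯.cotangent n)
    (LinearMap.inl k T (Module.Dual k T) ∘ₗ LinearMap.fst k T (Module.Dual k T)) :=
  fun _ _ he => ⟨he.1, Submodule.zero_mem _⟩

theorem isGradedMap_inr_snd : IsGradedMap (𝒯.cotangent n) (𝒯.cotangent n)
    (LinearMap.inr k T (Module.Dual k T) ∘ₗ LinearMap.snd k T (Module.Dual k T)) :=
  fun _ _ he => ⟨Submodule.zero_mem _, he.2⟩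

theorem splitArgs_mem {m : ℕ} {e : Fin m → T × Module.Dual k T} {a : Fin m → ℤ}
    (h : ∀ i, e i ∈ (𝒯.cotangent n).deg (a i)) (A : Finset (Fin m)) (i : Fin m) :
    splitArgs A e i ∈ (𝒯.cotangent n).deg (a i) := by
  simp only [splitArgs]
  split_ifs
  exacts [isGradedMap_inr_snd _ _ (h i), isGradedMap_inl_fst _ _ (h i)]

theorem GradedSymm.weightPart {φ : FormalMap k (T × Module.Dual k T) W}
    (hφ : GradedSymm (𝒯.cotangent n) φ) (j : ℕ) :
    GradedSymm (𝒯.cotangent n) fun m => weightPart j (φ m) := by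
  simpa only [weightPart_eq_distribute] using
    hφ.distribute isGradedMap_inr_snd isGradedMap_inl_fst j

theorem FunctionDegree.weightPart {d : ℤ} {φ : FormalMap k (T × Module.Dual k T) k}
    (hφ : FunctionDegree (𝒯.cotangent n) d φ) (j : ℕ) :
    FunctionDegree (𝒯.cotangent n) d fun m => weightPart j (φ m) := by
  simpa only [weightPart_eq_distribute] using
    hφ.distribute isGradedMap_inr_snd isGradedMap_inl_fst j

end FibreDegree

section LinearFunctions

theorem sum_eq_sum_singleton {M : Type*} [AddCommMonoid M] {m : ℕ} (F : Finset (Fin m) → M)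
    (h : ∀ s, s.card ≠ 1 → F s = 0) : ∑ s, F s = ∑ i, F {i} := by
  rw [← Finset.sum_subset (Finset.subset_univ (Finset.powersetCard 1 Finset.univ)) fun s _ hs =>
    h s (by simpa using hs)]
  simp [Finset.powersetCard_one]

theorem ofBilin_of_ne {k V : Type*} [Field k] [AddCommGroup V] [Module k V]
    (B : V →ₗ[k] V →ₗ[k] k) {m : ℕ} (hm : m ≠ 2) : ofBilin B m = 0 := by
  match m, hm with
  | 0, _ => rfl
  | 1, _ => rfl
  | m + 3, _ => rfl

variable {k : Type*} [Field k] {T : Type*} [AddCommGroup T] [Module k T] {𝒯 : Grading k T} {n : ℤ}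

theorem canonicalForm_injective : Function.Injective (canonicalForm 𝒯 n) := by
  rw [injective_iff_map_eq_zero]
  rintro ⟨x, ξ⟩ h
  have hξ : ξ = 0 := LinearMap.ext fun y => by
    simpa [canonicalForm] using LinearMap.congr_fun h (y, 0)
  have hx : 𝒯.signOp (n + 1) x = 0 := (Module.forall_dual_apply_eq_zero_iff k _).1 fun η => by
    simpa [canonicalForm] using LinearMap.congr_fun h (0, η)
  rw [hξ, ← 𝒯.signOp_signOp (n + 1) x, hx, map_zero, Prod.mk_zero_zero]

variable [FiniteDimensional k T]

theorem linearFunction_apply (Q : FormalMap k T T) {m : ℕ} {e : Fin m → T × Module.Dual k T}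
    {a : Fin m → ℤ} (h : ∀ i, e i ∈ (𝒯.cotangent n).deg (a i)) :
    linearFunction 𝒯 n Q m e = ∑ i, (koszulExponent a {i}ᶜ).negOnePow •
      canonicalForm 𝒯 n (evalList Q (({i}ᶜ : Finset (Fin m)).sort.map fun j => (e j).1), 0)
        (0, (e i).2) := by
  rw [linearFunction, derivAlong_apply _ _ h,
    ← Equiv.sum_comp (compl_involutive (α := Finset (Fin m))).toPerm, sum_eq_sum_singleton]
  · refine Finset.sum_congr rfl fun i _ => ?_
    simp only [Function.Involutive.coe_toPerm, compl_compl, Finset.sort_singleton]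
    have hbase : evalList (fun m => (LinearMap.inl k T (Module.Dual k T)).compMultilinearMap
        ((Q m).compLinearMap fun _ => LinearMap.fst k T (Module.Dual k T)))
          (({i}ᶜ : Finset (Fin m)).sort.map e) =
        (evalList Q (({i}ᶜ : Finset (Fin m)).sort.map fun j => (e j).1), 0) := by
      refine Prod.ext ((evalList_pullback (LinearMap.fst k T (Module.Dual k T)) Q _).trans ?_) rfl
      rw [List.map_map]
      rfl
    rw [hbase]
    rfl
  · intro s hs
    simp only [Function.Involutive.coe_toPerm, compl_compl]
    rw [evalList, ofBilin_of_ne _ (by simpa using hs), zero_apply, smul_zero]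

theorem canonicalForm_hamiltonian (F : FormalMap k (T × Module.Dual k T) k) {m : ℕ}
    (e : Fin m → T × Module.Dual k T) (u : T × Module.Dual k T) :
    canonicalForm 𝒯 n (hamiltonian 𝒯 n F m e) u = F (m + 1) (Fin.snoc e u) := by
  rw [hamiltonian, LinearMap.compMultilinearMap_apply, canonicalForm_sharp]
  rfl

variable {L : LInfinity 𝒯}

theorem totalHamiltonian_injective : Function.Injective (totalHamiltonian L n) :=
  fun _ _ h => funext fun m => add_left_cancel (congrFun h m)

end LinearFunctions

section Sub

variable {k : Type*} [Field k] {V W : Type*} [AddCommGroup V] [Module k V] [AddCommGroup W]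
  [Module k W] {𝒱 : Grading k V}

theorem GradedSymm.sub {φ ψ : FormalMap k V W} (hφ : GradedSymm 𝒱 φ) (hψ : GradedSymm 𝒱 ψ) :
    GradedSymm 𝒱 (φ - ψ) := fun m v i j hij a b hi hj => by
  simp only [Pi.sub_apply, sub_apply, hφ m v i j hij a b hi hj, hψ m v i j hij a b hi hj, smul_sub]

theorem FunctionDegree.sub {d : ℤ} {φ ψ : FormalMap k V k} (hφ : FunctionDegree 𝒱 d φ)
    (hψ : FunctionDegree 𝒱 d ψ) : FunctionDegree 𝒱 d (φ - ψ) := fun m v a h ha => by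
  rw [Pi.sub_apply, sub_apply, hφ m v a h ha, hψ m v a h ha, sub_zero]

end Sub

section HamiltonianOfSplitting

variable {k : Type*} [Field k] {G : Type*} [AddCommGroup G] [Module k G] {𝒢 : Grading k G}
  {T : Type*} [AddCommGroup T] [Module k T] {𝒯 : Grading k T} {X : LInfinity 𝒢} {n : ℤ}

/-- The Hamiltonian of `X` in the coordinates given by `Φ`. -/
def splitHamiltonian (ω : ShiftedSymplectic X n) (Φ : (T × Module.Dual k T) ≃ₗ[k] G) :
    FormalMap k (T × Module.Dual k T) k :=
  pullback Φ.toLinearMap (lower ω.form X.Q)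

/-- The components of fibre degree different from one of the Hamiltonian of `X` in the coordinates
given by `Φ`; for a splitting `Φ` this is the induced homotopy Poisson structure. -/
def splitPoisson (ω : ShiftedSymplectic X n) (Φ : (T × Module.Dual k T) ≃ₗ[k] G) :
    FormalMap k (T × Module.Dual k T) k :=
  splitHamiltonian ω Φ - fun m => weightPart 1 (splitHamiltonian ω Φ m)

theorem splitHamiltonian_apply (ω : ShiftedSymplectic X n) (Φ : (T × Module.Dual k T) ≃ₗ[k] G)
    {m : ℕ} (e : Fin (m + 1) → T × Module.Dual k T) :
    splitHamiltonian ω Φ (m + 1) e =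
      ω.form (X.Q m fun i => Φ (e i.castSucc)) (Φ (e (Fin.last m))) := rfl

theorem ShiftedSymplectic.functionDegree_lower (ω : ShiftedSymplectic X n) :
    FunctionDegree 𝒢 (n + 1) (lower ω.form X.Q) := by
  intro m v a h ha
  cases m with
  | zero => rfl
  | succ m =>
    refine ω.degree _ _ ?_ _ (X.degree m _ _ fun i => h i.castSucc) _ (h (Fin.last m))
    rw [Fin.sum_univ_castSucc] at ha
    omega

theorem weightPart_one_snoc {W : Type*} [AddCommGroup W] [Module k W] {m : ℕ}
    (φ : MultilinearMap k (fun _ : Fin (m + 1) => T × Module.Dual k T) W)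
    (e : Fin m → T × Module.Dual k T) (u : T × Module.Dual k T) :
    weightPart 1 φ (Fin.snoc e u : Fin (m + 1) → T × Module.Dual k T) =
      ∑ i, φ (Fin.snoc (splitArgs {i} e) (u.1, 0) : Fin (m + 1) → T × Module.Dual k T) +
        φ (Fin.snoc (fun i => ((e i).1, 0)) (0, u.2) : Fin (m + 1) → T × Module.Dual k T) := by
  rw [weightPart_one_apply, Fin.sum_univ_castSucc]
  congr 1
  · refine Finset.sum_congr rfl fun i _ => congrArg φ (funext fun j => ?_)
    cases j using Fin.lastCases <;> simp [splitArgs, (Fin.castSucc_lt_last i).ne']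
  · refine congrArg φ (funext fun j => ?_)
    cases j using Fin.lastCases <;> simp [splitArgs, (Fin.castSucc_lt_last _).ne]

variable {ω : ShiftedSymplectic X n} {L : LInfinity 𝒯} {f : T →ₗ[k] G}
  {Φ : (T × Module.Dual k T) ≃ₗ[k] G}

theorem IsRegularLagrangian.form_bracket_update (hf : IsRegularLagrangian ω L f) {w w' : G}
    (h : restrictForm ω f w = restrictForm ω f w') {m : ℕ} (v : Fin m → T) (i : Fin m) (y : T) :
    ω.form (X.Q m (Function.update (fun j => f (v j)) i w)) (f y) =
      ω.form (X.Q m (Function.update (fun j => f (v j)) i w')) (f y) := by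
  obtain ⟨x, hx⟩ := hf.sub_mem_range h
  have hupdate : Function.update (fun j => f (v j)) i (f x) =
      fun j => f (Function.update v i x j) := (Function.comp_update f v i x).symm
  rw [← sub_eq_zero, ← LinearMap.sub_apply, ← map_sub, ← MultilinearMap.map_update_sub, ← hx,
    hupdate, ← hf.strict.map_bracket, hf.isotropic]

variable [FiniteDimensional k T]

theorem IsPolyvector.apply_zero {d : ℤ} {P : FormalMap k (T × Module.Dual k T) k}
    (hP : IsPolyvector 𝒯 n d P) : P 0 = 0 := by
  rw [← sum_weightPart (P 0), zero_add, Finset.sum_range_one, hP.weight_zero]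

namespace IsSplitting

theorem gradedSymm_splitHamiltonian (hΦ : IsSplitting ω 𝒯 f Φ) :
    GradedSymm (𝒯.cotangent n) (splitHamiltonian ω Φ) := ω.invariant.pullback hΦ.map_deg

theorem functionDegree_splitHamiltonian (hΦ : IsSplitting ω 𝒯 f Φ) :
    FunctionDegree (𝒯.cotangent n) (n + 1) (splitHamiltonian ω Φ) :=
  ω.functionDegree_lower.pullback hΦ.map_deg

theorem isStrictMap_hamiltonian_iff (hΦ : IsSplitting ω 𝒯 f Φ)
    (F : FormalMap k (T × Module.Dual k T) k) :
    IsStrictMap (𝒯.cotangent n) 𝒢 (hamiltonian 𝒯 n F) X.Q Φ.toLinearMap ↔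
      ∀ m, F (m + 1) = splitHamiltonian ω Φ (m + 1) := by
  constructor
  · intro h m
    ext e
    have hsnoc := canonicalForm_hamiltonian (𝒯 := 𝒯) (n := n) F (Fin.init e) (e (Fin.last m))
    rw [Fin.snoc_init_self, ← hΦ.symplectic] at hsnoc
    rw [← hsnoc, splitHamiltonian_apply]
    exact congrArg (fun z => ω.form z _) (h.map_bracket m _)
  · intro h
    refine ⟨hΦ.map_deg, fun m e => ω.nondegenerate.1 (LinearMap.ext fun z => ?_)⟩
    obtain ⟨u, rfl⟩ := Φ.surjective z
    rw [LinearEquiv.coe_coe, hΦ.symplectic, canonicalForm_hamiltonian, h, splitHamiltonian_apply]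
    simp

theorem schouten_splitHamiltonian_self (hΦ : IsSplitting ω 𝒯 f Φ) :
    schouten 𝒯 n (splitHamiltonian ω Φ) (splitHamiltonian ω Φ) = 0 := by
  have hstrict := (hΦ.isStrictMap_hamiltonian_iff (splitHamiltonian ω Φ)).2 fun _ => rfl
  have hpullback := hstrict.derivAlong_pullback (lower ω.form X.Q)
  rwa [ω.derivAlong_lower] at hpullback

theorem weightPart_zero_splitHamiltonian (hΦ : IsSplitting ω 𝒯 f Φ)
    (hf : IsRegularLagrangian ω L f) (m : ℕ) : weightPart 0 (splitHamiltonian ω Φ m) = 0 := by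
  refine weightPart_eq_zero fun A hA e => ?_
  obtain rfl := Finset.card_eq_zero.1 hA
  cases m with
  | zero => rfl
  | succ m =>
    simp only [splitHamiltonian_apply, splitArgs, Finset.notMem_empty, if_false, hΦ.zero_section]
    rw [← hf.strict.map_bracket, hf.isotropic]

theorem weightPart_one_splitHamiltonian (hΦ : IsSplitting ω 𝒯 f Φ)
    (hf : IsRegularLagrangian ω L f) (m : ℕ) :
    weightPart 1 (splitHamiltonian ω Φ m) = linearFunction 𝒯 n L.Q m := by
  refine (𝒯.cotangent n).multilinear_ext fun e a h => ?_
  rw [linearFunction_apply L.Q h, weightPart_one_apply]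
  refine Finset.sum_congr rfl fun i _ => ?_
  have hbase : ((({i}ᶜ : Finset (Fin m)).sort.map (splitArgs {i} e)).map Φ.toLinearMap) =
      (({i}ᶜ : Finset (Fin m)).sort.map fun j => (e j).1).map f := by
    rw [List.map_map, List.map_map]
    refine List.map_congr_left fun j hj => ?_
    have hj : j ≠ i := by simpa using hj
    simp [splitArgs, hj, hΦ.zero_section]
  have hfibre : splitArgs {i} e i = (0, (e i).2) := by simp [splitArgs]
  rw [hΦ.gradedSymm_splitHamiltonian.apply_unshuffle (splitArgs_mem h {i}) {i}ᶜ, compl_compl,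
    Finset.sort_singleton, List.map_singleton, splitHamiltonian, evalList_pullback,
    List.map_append, List.map_singleton, evalList_lower_append, hbase, ← hf.strict.map_evalList,
    ← hΦ.zero_section, LinearEquiv.coe_coe, hΦ.symplectic, hfibre]

theorem totalHamiltonian_splitPoisson (hΦ : IsSplitting ω 𝒯 f Φ)
    (hf : IsRegularLagrangian ω L f) :
    totalHamiltonian L n (splitPoisson ω Φ) = splitHamiltonian ω Φ := by
  funext m
  simp only [totalHamiltonian, splitPoisson, Pi.sub_apply, hΦ.weightPart_one_splitHamiltonian hf,
    add_sub_cancel]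

theorem isPolyvector_splitPoisson (hΦ : IsSplitting ω 𝒯 f Φ)
    (hf : IsRegularLagrangian ω L f) : IsPolyvector 𝒯 n (n + 1) (splitPoisson ω Φ) where
  symm := hΦ.gradedSymm_splitHamiltonian.sub (hΦ.gradedSymm_splitHamiltonian.weightPart 1)
  degree := hΦ.functionDegree_splitHamiltonian.sub
    (hΦ.functionDegree_splitHamiltonian.weightPart 1)
  weight_zero m := by
    simp [splitPoisson, weightPart_sub, weightPart_weightPart,
      hΦ.weightPart_zero_splitHamiltonian hf]
  weight_one m := by simp [splitPoisson, weightPart_sub, weightPart_weightPart]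

theorem isStrictMap_twistedCotangent_iff (hΦ : IsSplitting ω 𝒯 f Φ)
    (hf : IsRegularLagrangian ω L f) {d : ℤ} {P : FormalMap k (T × Module.Dual k T) k}
    (hP : IsPolyvector 𝒯 n d P) :
    IsStrictMap (𝒯.cotangent n) 𝒢 (twistedCotangent L n P) X.Q Φ.toLinearMap ↔
      totalHamiltonian L n P = splitHamiltonian ω Φ := by
  have hconst : totalHamiltonian L n P 0 = splitHamiltonian ω Φ 0 := by
    rw [← hΦ.totalHamiltonian_splitPoisson hf, totalHamiltonian, totalHamiltonian, hP.apply_zero,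
      (hΦ.isPolyvector_splitPoisson hf).apply_zero]
  rw [twistedCotangent, hΦ.isStrictMap_hamiltonian_iff, funext_iff]
  exact ⟨fun h m => m.casesOn hconst h, fun h m => h (m + 1)⟩

theorem isInducedPoisson (hΦ : IsSplitting ω 𝒯 f Φ) (hf : IsRegularLagrangian ω L f)
    {P : FormalMap k (T × Module.Dual k T) k} (hP : IsPolyvector 𝒯 n (n + 1) P)
    (h : totalHamiltonian L n P = splitHamiltonian ω Φ) : IsInducedPoisson ω L f Φ P where
  splitting := hΦ
  poisson := ⟨hP, fun m => by rw [h, hΦ.schouten_splitHamiltonian_self, Pi.zero_apply]⟩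
  strict := (hΦ.isStrictMap_twistedCotangent_iff hf hP).2 h

theorem twistedCotangent_zero_apply (hΦ : IsSplitting ω 𝒯 f Φ)
    (hf : IsRegularLagrangian ω L f) {m : ℕ} (v : Fin m → T) (w : Fin m → G) :
    twistedCotangent L n 0 m (fun i => (v i, restrictForm ω f (w i))) =
      (L.Q m v, restrictForm ω f (∑ i, X.Q m (Function.update (fun j => f (v j)) i (w i)))) := by
  refine canonicalForm_injective (𝒯 := 𝒯) (n := n) (LinearMap.ext fun ⟨y, η⟩ => ?_)
  have htotal : totalHamiltonian L n 0 (m + 1) = weightPart 1 (splitHamiltonian ω Φ (m + 1)) := by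
    rw [totalHamiltonian, hΦ.weightPart_one_splitHamiltonian hf, Pi.zero_apply, add_zero]
  have hfibre : ω.form (X.Q m fun i => f (v i)) (Φ (0, η)) =
      canonicalForm 𝒯 n (L.Q m v, 0) (0, η) := by
    rw [← hf.strict.map_bracket, ← hΦ.zero_section, hΦ.symplectic]
  have hupdate : ∀ i, (fun j => Φ (splitArgs {i} (fun l => (v l, restrictForm ω f (w l))) j)) =
      Function.update (fun j => f (v j)) i (Φ (0, restrictForm ω f (w i))) := fun i => by
    ext j
    obtain rfl | hj := eq_or_ne j i <;> simp [*, splitArgs, hΦ.zero_section]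
  rw [twistedCotangent, canonicalForm_hamiltonian, htotal, weightPart_one_snoc]
  simp only [splitHamiltonian_apply, Fin.snoc_castSucc, Fin.snoc_last, hΦ.zero_section, hupdate,
    hfibre, hf.form_bracket_update (hΦ.restrictForm_inr _)]
  simp [canonicalForm, sub_eq_add_neg]

end IsSplitting

theorem IsInducedPoisson.totalHamiltonian_eq
    {P : FormalMap k (T × Module.Dual k T) k} (h : IsInducedPoisson ω L f Φ P)
    (hf : IsRegularLagrangian ω L f) : totalHamiltonian L n P = splitHamiltonian ω Φ :=
  (h.splitting.isStrictMap_twistedCotangent_iff hf h.poisson.polyvector).1 h.strict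

end HamiltonianOfSplitting

section Rescale

variable {k : Type*} [Field k] {T : Type*} [AddCommGroup T] [Module k T] {𝒯 : Grading k T} {n : ℤ}

theorem weightPart_rescale (c : k) (P : FormalMap k (T × Module.Dual k T) k) (i m : ℕ) :
    weightPart i (rescale c P m) = c ^ (i - 1) • weightPart i (P m) := by
  rw [rescale, weightPart_eq_distribute, map_sum]
  simp only [map_smul, ← weightPart_eq_distribute, weightPart_weightPart, smul_ite, smul_zero]
  rw [Finset.sum_ite_eq]
  split_ifs with h
  · rfl
  · rw [weightPart_eq_distribute, distribute_of_lt _ _ (by simpa using h), smul_zero]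

theorem rescale_one (P : FormalMap k (T × Module.Dual k T) k) : rescale 1 P = P := by
  funext m
  simp only [rescale, one_pow, one_smul, sum_weightPart]

theorem rescale_sub (c : k) (P P' : FormalMap k (T × Module.Dual k T) k) :
    rescale c (P - P') = rescale c P - rescale c P' := by
  funext m
  simp only [rescale, Pi.sub_apply, weightPart_sub, smul_sub, Finset.sum_sub_distrib]

theorem rescale_weightPart_one (c : k) (P : FormalMap k (T × Module.Dual k T) k) :
    rescale c (fun m => weightPart 1 (P m)) = fun m => weightPart 1 (P m) := by
  funext m
  simp only [rescale, weightPart_weightPart, smul_ite, smul_zero, Finset.sum_ite_eq']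
  split_ifs with h
  · simp
  · rw [weightPart_eq_distribute, distribute_of_lt _ _ (by simpa using h)]

theorem evalList_rescale (c : k) (F : FormalMap k (T × Module.Dual k T) k)
    (l : List (T × Module.Dual k T)) :
    evalList (rescale c F) l = ∑ j ∈ Finset.range (l.length + 1),
      c ^ (j - 1) * evalList (fun m => weightPart j (F m)) l := by
  simp only [evalList, rescale, sum_apply, smul_apply, smul_eq_mul]

variable [FiniteDimensional k T]

theorem IsPolyvector.rescale {d : ℤ} {P : FormalMap k (T × Module.Dual k T) k}
    (hP : IsPolyvector 𝒯 n d P) (c : k) : IsPolyvector 𝒯 n d (rescale c P) where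
  symm m v i j hij a b hi hj := by
    simp only [FormalModuli.rescale, sum_apply, smul_apply, Finset.smul_sum]
    refine Finset.sum_congr rfl fun r _ => ?_
    rw [hP.symm.weightPart r m v i j hij a b hi hj, smul_comm]
  degree m v a h ha := by
    simp only [FormalModuli.rescale, sum_apply, smul_apply]
    exact Finset.sum_eq_zero fun r _ => by rw [hP.degree.weightPart r m v a h ha, smul_zero]
  weight_zero m := by rw [weightPart_rescale, hP.weight_zero, smul_zero]
  weight_one m := by rw [weightPart_rescale, hP.weight_one, smul_zero]

theorem IsPolyvector.rescale_zero {d : ℤ} {P : FormalMap k (T × Module.Dual k T) k}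
    (hP : IsPolyvector 𝒯 n d P) : FormalModuli.rescale 0 P = 0 := by
  funext m
  refine Finset.sum_eq_zero fun j _ => ?_
  match j with
  | 0 => rw [hP.weight_zero, smul_zero]
  | 1 => rw [hP.weight_one, smul_zero]
  | j + 2 => simp

theorem evalList_hamiltonian_rescale (c : k) (F : FormalMap k (T × Module.Dual k T) k)
    (l : List (T × Module.Dual k T)) : evalList (hamiltonian 𝒯 n (rescale c F)) l =
      ∑ j ∈ Finset.range (l.length + 2),
        c ^ (j - 1) • evalList (hamiltonian 𝒯 n fun m => weightPart j (F m)) l := by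
  refine canonicalForm_injective (𝒯 := 𝒯) (n := n) (LinearMap.ext fun u => ?_)
  simp only [evalList, map_sum, map_smul, LinearMap.sum_apply, LinearMap.smul_apply,
    canonicalForm_hamiltonian, rescale, sum_apply, smul_apply]

theorem exists_polynomial_evalList_hamiltonian_rescale
    (F : FormalMap k (T × Module.Dual k T) k) (l l' : List (T × Module.Dual k T)) :
    ∃ p : Polynomial k, ∀ c,
      evalList (rescale c F) (evalList (hamiltonian 𝒯 n (rescale c F)) l :: l') = p.eval c := by
  refine ⟨∑ i ∈ Finset.range (l.length + 2), Polynomial.X ^ (i - 1) *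
    ∑ j ∈ Finset.range (l'.length + 1 + 1), Polynomial.X ^ (j - 1) *
      Polynomial.C (evalList (fun m => weightPart j (F m))
        (evalList (hamiltonian 𝒯 n fun m => weightPart i (F m)) l :: l')), fun c => ?_⟩
  rw [evalList_cons, evalList_hamiltonian_rescale]
  simp only [map_sum, map_smul, sum_apply, smul_apply, ← evalList_cons, evalList_rescale,
    List.length_cons, Polynomial.eval_finsetSum, Polynomial.eval_mul, Polynomial.eval_pow,
    Polynomial.eval_X, Polynomial.eval_C, smul_eq_mul]

/-- On fixed arguments the bracket is a polynomial in `c`, so its vanishing for `c ≠ 0` extends to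
`c = 0`. -/
theorem schouten_rescale_self [Infinite k] {F : FormalMap k (T × Module.Dual k T) k}
    (h : ∀ c ≠ 0, schouten 𝒯 n (rescale c F) (rescale c F) = 0) (c : k) :
    schouten 𝒯 n (rescale c F) (rescale c F) = 0 := by
  funext m
  refine (𝒯.cotangent n).multilinear_ext fun e a he => ?_
  choose p hp using fun s : Finset (Fin m) =>
    exists_polynomial_evalList_hamiltonian_rescale (𝒯 := 𝒯) (n := n) F (s.sort.map e)
      (sᶜ.sort.map e)
  let q : Polynomial k := ∑ s, (koszulExponent a s).negOnePow • p s
  have hq : ∀ c, schouten 𝒯 n (rescale c F) (rescale c F) m e = q.eval c := fun c => by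
    simp only [q, schouten, derivAlong_apply _ _ he, hp, Polynomial.eval_finsetSum, Units.smul_def,
      Polynomial.eval_smul]
  have hXq : Polynomial.X * q = 0 := Polynomial.funext fun c => by
    by_cases hc : c = 0
    · simp [hc]
    · rw [Polynomial.eval_mul, ← hq, h c hc]
      simp
  rw [hq, (mul_eq_zero.1 hXq).resolve_left Polynomial.X_ne_zero, Polynomial.eval_zero]
  rfl

end Rescale

section NormalCone

/-- Dilation of the fibres of `T^*[n]L` by a nonzero scalar, as a linear isomorphism. -/
def dilationEquiv (k T : Type*) [Field k] [AddCommGroup T] [Module k T] (c : k) (hc : c ≠ 0) :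
    (T × Module.Dual k T) ≃ₗ[k] (T × Module.Dual k T) :=
  (LinearEquiv.refl k T).prodCongr (LinearEquiv.smulOfNeZero k (Module.Dual k T) c hc)

variable {k : Type*} [Field k] {G : Type*} [AddCommGroup G] [Module k G] {𝒢 : Grading k G}
  {T : Type*} [AddCommGroup T] [Module k T] {𝒯 : Grading k T} {X : LInfinity 𝒢} {n : ℤ}

/-- The symplectic structure `c⁻¹ ω`, for which the dilation by `c` of a splitting of `ω` is again
symplectic. -/
def ShiftedSymplectic.invScale (ω : ShiftedSymplectic X n) (c : k) (hc : c ≠ 0) :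
    ShiftedSymplectic X n where
  form := c⁻¹ • ω.form
  degree a b h x hx y hy := by simp [ω.degree a b h x hx y hy]
  antisymm a b x hx y hy := by
    simp only [LinearMap.smul_apply, ω.antisymm a b x hx y hy, smul_neg, smul_comm c⁻¹]
  nondegenerate :=
    (LinearEquiv.smulOfNeZero k (Module.Dual k G) c⁻¹ (inv_ne_zero hc)).bijective.comp
      ω.nondegenerate
  invariant m v i j hij a b hi hj := by
    cases m with
    | zero => exact i.elim0
    | succ m =>
      have h := congrArg (c⁻¹ • ·) (ω.invariant (m + 1) v i j hij a b hi hj)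
      rwa [smul_comm] at h

variable {ω : ShiftedSymplectic X n} {L : LInfinity 𝒯} {f : T →ₗ[k] G}
  {Φ : (T × Module.Dual k T) ≃ₗ[k] G}

theorem IsRegularLagrangian.invScale (hf : IsRegularLagrangian ω L f) (c : k) (hc : c ≠ 0) :
    IsRegularLagrangian (ω.invScale c hc) L f where
  strict := hf.strict
  injective := hf.injective
  isotropic x y := by simp [ShiftedSymplectic.invScale, hf.isotropic]
  coisotropic y h := hf.coisotropic y fun x => by
    simpa [ShiftedSymplectic.invScale, hc] using h x

variable [FiniteDimensional k T]

namespace IsSplitting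

theorem dilation (hΦ : IsSplitting ω 𝒯 f Φ) (c : k) (hc : c ≠ 0) :
    IsSplitting (ω.invScale c hc) 𝒯 f ((dilationEquiv k T c hc).trans Φ) where
  map_deg i e he := hΦ.map_deg i _ ⟨he.1, Submodule.smul_mem _ c he.2⟩
  zero_section x := by
    rw [← hΦ.zero_section]
    simp [dilationEquiv]
  symplectic e e' := by
    change c⁻¹ • ω.form (Φ (e.1, c • e.2)) (Φ (e'.1, c • e'.2)) = _
    rw [hΦ.symplectic]
    simp only [canonicalForm, LinearMap.mk₂_apply, LinearMap.smul_apply, smul_eq_mul]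
    field_simp

theorem splitHamiltonian_dilation (hΦ : IsSplitting ω 𝒯 f Φ) (hf : IsRegularLagrangian ω L f)
    (c : k) (hc : c ≠ 0) : splitHamiltonian (ω.invScale c hc) ((dilationEquiv k T c hc).trans Φ) =
      rescale c (splitHamiltonian ω Φ) := by
  have hpullback : ∀ m, splitHamiltonian (ω.invScale c hc) ((dilationEquiv k T c hc).trans Φ) m =
      c⁻¹ • (splitHamiltonian ω Φ m).compLinearMap fun _ => FormalModuli.dilation k T c := by
    rintro (_ | m)
    · exact (smul_zero c⁻¹).symm
    · rfl
  funext m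
  rw [hpullback, compLinearMap_dilation, Finset.smul_sum]
  refine Finset.sum_congr rfl fun j _ => ?_
  cases j with
  | zero => simp [hΦ.weightPart_zero_splitHamiltonian hf]
  | succ j => rw [smul_smul, pow_succ', inv_mul_cancel_left₀ hc, Nat.add_sub_cancel]

theorem totalHamiltonian_rescale_splitPoisson (hΦ : IsSplitting ω 𝒯 f Φ)
    (hf : IsRegularLagrangian ω L f) (c : k) :
    totalHamiltonian L n (rescale c (splitPoisson ω Φ)) = rescale c (splitHamiltonian ω Φ) := by
  funext m
  simp only [totalHamiltonian, splitPoisson, rescale_sub, rescale_weightPart_one, Pi.sub_apply,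
    ← hΦ.weightPart_one_splitHamiltonian hf, add_sub_cancel]

end IsSplitting

namespace IsInducedPoisson

variable {P : FormalMap k (T × Module.Dual k T) k}

theorem totalHamiltonian_rescale (h : IsInducedPoisson ω L f Φ P)
    (hf : IsRegularLagrangian ω L f) (c : k) :
    totalHamiltonian L n (FormalModuli.rescale c P) =
      FormalModuli.rescale c (splitHamiltonian ω Φ) := by
  have hP : P = splitPoisson ω Φ := totalHamiltonian_injective (L := L) (n := n) <| by
    rw [h.totalHamiltonian_eq hf, h.splitting.totalHamiltonian_splitPoisson hf]
  rw [hP, h.splitting.totalHamiltonian_rescale_splitPoisson hf]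

theorem rescale (h : IsInducedPoisson ω L f Φ P) (hf : IsRegularLagrangian ω L f) (c : k)
    (hc : c ≠ 0) : IsInducedPoisson (ω.invScale c hc) L f ((dilationEquiv k T c hc).trans Φ)
      (FormalModuli.rescale c P) := by
  refine (h.splitting.dilation c hc).isInducedPoisson (hf.invScale c hc)
    (h.poisson.polyvector.rescale c) ?_
  rw [h.totalHamiltonian_rescale hf, h.splitting.splitHamiltonian_dilation hf]

theorem isHomotopyPoisson_rescale [Infinite k] (h : IsInducedPoisson ω L f Φ P)
    (hf : IsRegularLagrangian ω L f) (c : k) :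
    IsHomotopyPoisson L n (FormalModuli.rescale c P) := by
  refine ⟨h.poisson.polyvector.rescale c, congrFun ?_⟩
  rw [h.totalHamiltonian_rescale hf]
  refine schouten_rescale_self (fun c hc => ?_) c
  rw [← h.totalHamiltonian_rescale hf]
  exact funext (h.rescale hf c hc).poisson.maurerCartan

end IsInducedPoisson

end NormalCone

section QuadraticFunctions

variable {k : Type*} [Field k]

section GradedFunctions

variable {V W : Type*} [AddCommGroup V] [Module k V] [AddCommGroup W] [Module k W]
  {𝒱 : Grading k V}

theorem gradedSymm_ofBilin {β : V →ₗ[k] V →ₗ[k] k}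
    (hβ : ∀ a b : ℤ, ∀ x ∈ 𝒱.deg a, ∀ y ∈ 𝒱.deg b, β y x = (a * b).negOnePow • β x y) :
    GradedSymm 𝒱 (ofBilin β) := by
  intro m v i j hij a b hi hj
  obtain rfl | hm := eq_or_ne m 2
  · obtain rfl : i = 0 := Fin.ext (by simp; omega)
    obtain rfl : j = 1 := Fin.ext (by simp; omega)
    exact hβ a b _ hi _ hj
  · rw [ofBilin_of_ne _ hm, zero_apply, zero_apply, smul_zero]

theorem functionDegree_ofBilin {β : V →ₗ[k] V →ₗ[k] k} {d : ℤ}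
    (hβ : ∀ a b : ℤ, d + (a + b) ≠ 0 → ∀ x ∈ 𝒱.deg a, ∀ y ∈ 𝒱.deg b, β x y = 0) :
    FunctionDegree 𝒱 d (ofBilin β) := by
  intro m v a h ha
  obtain rfl | hm := eq_or_ne m 2
  · exact hβ _ _ (by rwa [Fin.sum_univ_two] at ha) _ (h 0) _ (h 1)
  · rw [ofBilin_of_ne _ hm, zero_apply]

theorem derivAlong_of_linear {X : FormalMap k V V} {N : V →ₗ[k] V} (hN : IsGradedMap 𝒱 𝒱 N)
    (hX : ∀ m ≠ 1, X m = 0) (hXN : ∀ v, X 1 v = N (v 0)) {φ : FormalMap k V W}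
    (hφ : GradedSymm 𝒱 φ) :
    derivAlong 𝒱 X φ = fun m => distribute N LinearMap.id 1 (φ m) := by
  funext m
  refine 𝒱.multilinear_ext fun v a h => ?_
  rw [derivAlong_apply _ _ h, distribute_one_apply, sum_eq_sum_singleton]
  · refine Finset.sum_congr rfl fun i _ => ?_
    have hmem : ∀ j, (if j = i then N (v j) else v j) ∈ 𝒱.deg (a j) := fun j => by
      split_ifs
      exacts [hN _ _ (h j), h j]
    have hrest : ({i}ᶜ : Finset (Fin m)).sort.map (fun j => if j = i then N (v j) else v j) =
        ({i}ᶜ : Finset (Fin m)).sort.map v := by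
      refine List.map_congr_left fun j hj => if_neg ?_
      simpa using hj
    have hX : evalList X [v i] = N (v i) := hXN _
    simp only [LinearMap.id_apply]
    rw [hφ.apply_unshuffle hmem {i}, hrest, Finset.sort_singleton, List.map_singleton,
      List.map_singleton, if_pos rfl, hX, List.singleton_append]
  · intro s hs
    have hzero : evalList X (s.sort.map v) = 0 := by
      rw [evalList, hX _ (by simpa using hs), zero_apply]
    rw [hzero, evalList_cons, map_zero, zero_apply, smul_zero]

end GradedFunctions

variable {T : Type*} [AddCommGroup T] [Module k T] [FiniteDimensional k T] {𝒯 : Grading k T}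
  {n : ℤ}

theorem isPolyvector_ofBilin {d : ℤ}
    {β : (T × Module.Dual k T) →ₗ[k] (T × Module.Dual k T) →ₗ[k] k}
    (hsymm : GradedSymm (𝒯.cotangent n) (ofBilin β))
    (hdeg : FunctionDegree (𝒯.cotangent n) d (ofBilin β))
    (hleft : ∀ x e, β (x, 0) e = 0) (hright : ∀ e x, β e (x, 0) = 0) :
    IsPolyvector 𝒯 n d (ofBilin β) := by
  have hweight : ∀ j < 2, ∀ m, weightPart j (ofBilin β m) = 0 := fun j hj m =>
    weightPart_eq_zero fun A hA e => by
      obtain rfl | hm := eq_or_ne m 2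
      · obtain ⟨i, hi⟩ : ∃ i, i ∉ A := by
          by_contra! h
          rw [Finset.eq_univ_of_forall h, Finset.card_univ, Fintype.card_fin] at hA
          omega
        have hbase : splitArgs A e i = ((e i).1, 0) := if_neg hi
        change β (splitArgs A e 0) (splitArgs A e 1) = 0
        obtain rfl | rfl : i = 0 ∨ i = 1 := by omega
        · rw [hbase, hleft]
        · rw [hbase, hright]
      · rw [ofBilin_of_ne _ hm, zero_apply]
  exact ⟨hsymm, hdeg, hweight 0 two_pos, hweight 1 one_lt_two⟩

variable {N : (T × Module.Dual k T) →ₗ[k] (T × Module.Dual k T)}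
  {F : FormalMap k (T × Module.Dual k T) k}

theorem schouten_ofBilin (hN : IsGradedMap (𝒯.cotangent n) (𝒯.cotangent n) N)
    (hF : GradedSymm (𝒯.cotangent n) F) :
    schouten 𝒯 n (ofBilin (canonicalForm 𝒯 n ∘ₗ N)) F =
      fun m => distribute N LinearMap.id 1 (F m) := by
  refine derivAlong_of_linear hN (fun m hm => ?_) (fun v => ?_) hF
  · rw [hamiltonian, ofBilin_of_ne _ (by omega)]
    exact MultilinearMap.ext fun _ => map_zero (sharp 𝒯 n)
  · refine canonicalForm_injective (𝒯 := 𝒯) (n := n) (LinearMap.ext fun u => ?_)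
    rw [canonicalForm_hamiltonian]
    rfl

theorem iterate_schouten_ofBilin (hN : IsGradedMap (𝒯.cotangent n) (𝒯.cotangent n) N)
    (hNN : ∀ e, N (N e) = 0) (hF : GradedSymm (𝒯.cotangent n) F) (r : ℕ) :
    (schouten 𝒯 n (ofBilin (canonicalForm 𝒯 n ∘ₗ N)))^[r] F =
      fun m => r.factorial • distribute N LinearMap.id r (F m) := by
  induction r with
  | zero =>
    funext m
    ext e
    simp [distribute_apply]
  | succ r ih =>
    have hsymm : GradedSymm (𝒯.cotangent n)
        fun m => r.factorial • distribute N LinearMap.id r (F m) :=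
      fun m v i j hij a b hi hj => by
        rw [smul_apply, smul_apply, hF.distribute hN (fun _ _ he => he) r m v i j hij a b hi hj,
          smul_comm]
    rw [Function.iterate_succ_apply', ih, schouten_ofBilin hN hsymm]
    funext m
    rw [map_nsmul, distribute_one_distribute hNN, smul_smul, mul_comm, ← Nat.factorial_succ]

theorem pullback_id_add_eq_sum_iterate_schouten [CharZero k]
    (hN : IsGradedMap (𝒯.cotangent n) (𝒯.cotangent n) N) (hNN : ∀ e, N (N e) = 0)
    (hF : GradedSymm (𝒯.cotangent n) F) (m : ℕ) :
    pullback (LinearMap.id + N) F m = ∑ r ∈ Finset.range (m + 1),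
      (r.factorial : k)⁻¹ • ((schouten 𝒯 n (ofBilin (canonicalForm 𝒯 n ∘ₗ N)))^[r] F) m := by
  have hadd := compLinearMap_add_smul N LinearMap.id 1 (F m)
  simp only [one_smul, one_pow] at hadd
  refine hadd.trans (Finset.sum_congr rfl fun r _ => ?_)
  simp only [iterate_schouten_ofBilin hN hNN hF]
  rw [← Nat.cast_smul_eq_nsmul k, inv_smul_smul₀ (Nat.cast_ne_zero.2 r.factorial_ne_zero)]

end QuadraticFunctions

section Shear

variable {k : Type*} [Field k] {G : Type*} [AddCommGroup G] [Module k G] {𝒢 : Grading k G}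
  {T : Type*} [AddCommGroup T] [Module k T]

/-- The difference of two splittings in the coordinates of the first: `Φ' = Φ ∘ (id + N)` for
`N = shear Φ Φ'`. -/
def shear (Φ Φ' : (T × Module.Dual k T) ≃ₗ[k] G) :
    (T × Module.Dual k T) →ₗ[k] (T × Module.Dual k T) :=
  Φ.symm.toLinearMap ∘ₗ Φ'.toLinearMap - LinearMap.id

theorem map_shear (Φ Φ' : (T × Module.Dual k T) ≃ₗ[k] G) (e : T × Module.Dual k T) :
    Φ (shear Φ Φ' e) = Φ' e - Φ e := by
  simp [shear]

theorem map_add_shear (Φ Φ' : (T × Module.Dual k T) ≃ₗ[k] G) (e : T × Module.Dual k T) :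
    Φ (e + shear Φ Φ' e) = Φ' e := by
  rw [map_add, map_shear, add_sub_cancel]

variable {𝒯 : Grading k T} {X : LInfinity 𝒢} {n : ℤ} {ω : ShiftedSymplectic X n}
  {Φ Φ' : (T × Module.Dual k T) ≃ₗ[k] G}

theorem splitHamiltonian_eq_pullback_shear :
    splitHamiltonian ω Φ' = pullback (LinearMap.id + shear Φ Φ') (splitHamiltonian ω Φ) := by
  funext m
  ext e
  exact congrArg (lower ω.form X.Q m) (funext fun i => (map_add_shear Φ Φ' (e i)).symm)

variable {L : LInfinity 𝒯} {f : T →ₗ[k] G} [FiniteDimensional k T]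

namespace IsSplitting

theorem isGradedMap_shear (hΦ : IsSplitting ω 𝒯 f Φ) (hΦ' : IsSplitting ω 𝒯 f Φ') :
    IsGradedMap (𝒯.cotangent n) (𝒯.cotangent n) (shear Φ Φ') := fun i e he =>
  Submodule.sub_mem _ (IsGradedMap.symm hΦ.map_deg i _ (hΦ'.map_deg i e he)) he

theorem shear_inl (hΦ : IsSplitting ω 𝒯 f Φ) (hΦ' : IsSplitting ω 𝒯 f Φ') (x : T) :
    shear Φ Φ' (x, 0) = 0 := Φ.injective <| by
  rw [map_shear, hΦ.zero_section, hΦ'.zero_section, sub_self, map_zero]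

theorem exists_shear_eq_inl (hΦ : IsSplitting ω 𝒯 f Φ) (hΦ' : IsSplitting ω 𝒯 f Φ')
    (hf : IsRegularLagrangian ω L f) (e : T × Module.Dual k T) :
    ∃ x, shear Φ Φ' e = (x, 0) := by
  have hfibre : shear Φ Φ' e = shear Φ Φ' (0, e.2) := by
    rw [← Prod.fst_add_snd e, map_add, hΦ.shear_inl hΦ', zero_add]
    simp
  obtain ⟨x, hx⟩ := hf.sub_mem_range (w := Φ' (0, e.2)) (w' := Φ (0, e.2)) <| by
    rw [hΦ.restrictForm_inr, hΦ'.restrictForm_inr]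
  exact ⟨x, Φ.injective <| by rw [hfibre, map_shear, hΦ.zero_section, hx]⟩

theorem shear_shear (hΦ : IsSplitting ω 𝒯 f Φ) (hΦ' : IsSplitting ω 𝒯 f Φ')
    (hf : IsRegularLagrangian ω L f) (e : T × Module.Dual k T) :
    shear Φ Φ' (shear Φ Φ' e) = 0 := by
  obtain ⟨x, hx⟩ := hΦ.exists_shear_eq_inl hΦ' hf e
  rw [hx, hΦ.shear_inl hΦ']

theorem canonicalForm_shear_inl (hΦ : IsSplitting ω 𝒯 f Φ) (hΦ' : IsSplitting ω 𝒯 f Φ')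
    (hf : IsRegularLagrangian ω L f) (e : T × Module.Dual k T) (x : T) :
    canonicalForm 𝒯 n (shear Φ Φ' e) (x, 0) = 0 := by
  obtain ⟨y, hy⟩ := hΦ.exists_shear_eq_inl hΦ' hf e
  simp [hy, canonicalForm]

theorem canonicalForm_shear (hΦ : IsSplitting ω 𝒯 f Φ) (hΦ' : IsSplitting ω 𝒯 f Φ')
    (hf : IsRegularLagrangian ω L f) (e e' : T × Module.Dual k T) :
    canonicalForm 𝒯 n (shear Φ Φ' e) e' = -canonicalForm 𝒯 n e (shear Φ Φ' e') := by
  have hsymplectic := hΦ'.symplectic e e'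
  obtain ⟨x, hx⟩ := hΦ.exists_shear_eq_inl hΦ' hf e'
  have hbase : canonicalForm 𝒯 n (shear Φ Φ' e) (shear Φ Φ' e') = 0 := by
    rw [hx, hΦ.canonicalForm_shear_inl hΦ' hf]
  rw [← map_add_shear Φ Φ' e, ← map_add_shear Φ Φ' e', hΦ.symplectic] at hsymplectic
  simp only [map_add, LinearMap.add_apply, hbase] at hsymplectic
  linear_combination hsymplectic

theorem isPolyvector_shear (hΦ : IsSplitting ω 𝒯 f Φ) (hΦ' : IsSplitting ω 𝒯 f Φ')
    (hf : IsRegularLagrangian ω L f) :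
    IsPolyvector 𝒯 n n (ofBilin (canonicalForm 𝒯 n ∘ₗ shear Φ Φ')) := by
  have hgraded := hΦ.isGradedMap_shear hΦ'
  refine isPolyvector_ofBilin (gradedSymm_ofBilin fun a b x hx y hy => ?_)
    (functionDegree_ofBilin fun a b hab x hx y hy => ?_) (fun x e => ?_)
    (hΦ.canonicalForm_shear_inl hΦ' hf)
  · simp only [LinearMap.comp_apply]
    rw [hΦ.canonicalForm_shear hΦ' hf, ← hΦ.symplectic y, ← hΦ.symplectic _ y,
      ω.antisymm b a _ (hΦ.map_deg _ _ hy) _ (hΦ.map_deg _ _ (hgraded _ _ hx)), neg_neg, mul_comm]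
  · rw [LinearMap.comp_apply, ← hΦ.symplectic]
    exact ω.degree a b (by omega) _ (hΦ.map_deg _ _ (hgraded _ _ hx)) _ (hΦ.map_deg _ _ hy)
  · rw [LinearMap.comp_apply, hΦ.shear_inl hΦ', map_zero, LinearMap.zero_apply]

end IsSplitting

theorem IsInducedPoisson.gaugeEquivalent [CharZero k] {P P' : FormalMap k (T × Module.Dual k T) k}
    (h : IsInducedPoisson ω L f Φ P) (h' : IsInducedPoisson ω L f Φ' P')
    (hf : IsRegularLagrangian ω L f) : GaugeEquivalent L n P P' := by
  have hΦ := h.splitting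
  have hΦ' := h'.splitting
  refine ⟨_, hΦ.isPolyvector_shear hΦ' hf, fun m => ?_⟩
  rw [h.totalHamiltonian_eq hf, h'.totalHamiltonian_eq hf,
    splitHamiltonian_eq_pullback_shear (Φ := Φ)]
  exact pullback_id_add_eq_sum_iterate_schouten (hΦ.isGradedMap_shear hΦ') (hΦ.shear_shear hΦ' hf)
    hΦ.gradedSymm_splitHamiltonian m

end Shear

section Naturality

variable {k : Type*} [Field k] {G : Type*} [AddCommGroup G] [Module k G] {𝒢 : Grading k G}
  {T : Type*} [AddCommGroup T] [Module k T] {𝒯 : Grading k T}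
  {X : LInfinity 𝒢} {n : ℤ} {ω : ShiftedSymplectic X n} {L : LInfinity 𝒯} {f : T →ₗ[k] G}
  {Φ : (T × Module.Dual k T) ≃ₗ[k] G} {P : FormalMap k (T × Module.Dual k T) k}
  {G' : Type*} [AddCommGroup G'] [Module k G'] {𝒢' : Grading k G'}
  {T' : Type*} [AddCommGroup T'] [Module k T'] {𝒯' : Grading k T'}
  {X' : LInfinity 𝒢'} {ω' : ShiftedSymplectic X' n} {L' : LInfinity 𝒯'} {f' : T' →ₗ[k] G'}
  {ψ : G ≃ₗ[k] G'} {χ : T ≃ₗ[k] T'}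

theorem splitHamiltonian_transport (hψ : IsStrictMap 𝒢 𝒢' X.Q X'.Q ψ.toLinearMap)
    (hω : ∀ x y, ω'.form (ψ x) (ψ y) = ω.form x y) :
    splitHamiltonian ω' (((χ.prodCongr χ.dualMap.symm).symm.trans Φ).trans ψ) =
      pushforward χ (splitHamiltonian ω Φ) := by
  funext m
  cases m with
  | zero => rfl
  | succ m =>
    ext e
    rw [pushforward, MultilinearMap.compLinearMap_apply, splitHamiltonian_apply,
      splitHamiltonian_apply, ← hω]
    exact congrArg (fun z => ω'.form z _) (hψ.map_bracket m _).symm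

theorem IsStrictMap.symm {Q : FormalMap k T T} {Q' : FormalMap k T' T'}
    (hχ : IsStrictMap 𝒯 𝒯' Q Q' χ.toLinearMap) : IsStrictMap 𝒯' 𝒯 Q' Q χ.symm.toLinearMap where
  map_deg := IsGradedMap.symm hχ.map_deg
  map_bracket m v := χ.injective <| by
    simpa using (hχ.map_bracket m fun i => χ.symm (v i)).symm

theorem IsStrictMap.comp {V : Type*} [AddCommGroup V] [Module k V] {𝒱 : Grading k V}
    {Q₁ : FormalMap k V V} {Q₂ : FormalMap k G G} {Q₃ : FormalMap k G' G'} {g : G →ₗ[k] G'}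
    {h : V →ₗ[k] G} (hg : IsStrictMap 𝒢 𝒢' Q₂ Q₃ g) (hh : IsStrictMap 𝒱 𝒢 Q₁ Q₂ h) :
    IsStrictMap 𝒱 𝒢' Q₁ Q₃ (g ∘ₗ h) where
  map_deg := IsGradedMap.comp hg.map_deg hh.map_deg
  map_bracket m v := by
    rw [LinearMap.comp_apply, hh.map_bracket, hg.map_bracket]
    rfl

theorem IsRegularLagrangian.transport (hf : IsRegularLagrangian ω L f)
    (hψ : IsStrictMap 𝒢 𝒢' X.Q X'.Q ψ.toLinearMap) (hχ : IsStrictMap 𝒯 𝒯' L.Q L'.Q χ.toLinearMap)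
    (hω : ∀ x y, ω'.form (ψ x) (ψ y) = ω.form x y) (hff' : ∀ x, ψ (f x) = f' (χ x)) :
    IsRegularLagrangian ω' L' f' := by
  obtain rfl : f' = ψ.toLinearMap ∘ₗ f ∘ₗ χ.symm.toLinearMap :=
    LinearMap.ext fun y => by simp [hff']
  exact
    { strict := hψ.comp (hf.strict.comp hχ.symm)
      injective := ψ.injective.comp (hf.injective.comp χ.symm.injective)
      isotropic := fun x y => (hω _ _).trans (hf.isotropic _ _)
      coisotropic := fun y h => by
        obtain ⟨x, hx⟩ := hf.coisotropic (ψ.symm y) fun x => by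
          rw [← hω, ψ.apply_symm_apply, hff', h]
        exact ⟨χ x, by simp [hx]⟩ }

variable [FiniteDimensional k T] [FiniteDimensional k T']

theorem isGradedMap_prodMap_dualMap (hχ : IsGradedMap 𝒯 𝒯' χ.toLinearMap) :
    IsGradedMap (𝒯'.cotangent n) (𝒯.cotangent n)
      (χ.symm.toLinearMap.prodMap χ.dualMap.toLinearMap) := fun i _ he =>
  ⟨IsGradedMap.symm hχ i _ he.1, hχ.dualMap n i _ he.2⟩

theorem IsSplitting.transport (hΦ : IsSplitting ω 𝒯 f Φ)
    (hψ : IsGradedMap 𝒢 𝒢' ψ.toLinearMap) (hχ : IsGradedMap 𝒯 𝒯' χ.toLinearMap)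
    (hω : ∀ x y, ω'.form (ψ x) (ψ y) = ω.form x y) (hff' : ∀ x, ψ (f x) = f' (χ x)) :
    IsSplitting ω' 𝒯' f' (((χ.prodCongr χ.dualMap.symm).symm.trans Φ).trans ψ) where
  map_deg i e he := hψ i _ (hΦ.map_deg i _ (isGradedMap_prodMap_dualMap hχ i e he))
  zero_section y := by
    change ψ (Φ (χ.symm y, χ.dualMap 0)) = f' y
    rw [map_zero, hΦ.zero_section, hff', χ.apply_symm_apply]
  symplectic e e' := by
    change ω'.form (ψ (Φ (χ.symm e.1, χ.dualMap e.2))) (ψ (Φ (χ.symm e'.1, χ.dualMap e'.2))) = _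
    have hsign : χ (𝒯.signOp (n + 1) (χ.symm e.1)) = 𝒯'.signOp (n + 1) e.1 :=
      (hχ.map_act _ _).trans (congrArg _ (χ.apply_symm_apply _))
    rw [hω, hΦ.symplectic]
    simp only [canonicalForm, LinearMap.mk₂_apply, LinearEquiv.dualMap_apply,
      LinearEquiv.apply_symm_apply, hsign]

theorem IsPolyvector.pushforward {d : ℤ} (hP : IsPolyvector 𝒯 n d P)
    (hχ : IsGradedMap 𝒯 𝒯' χ.toLinearMap) : IsPolyvector 𝒯' n d (pushforward χ P) where
  symm := hP.symm.pullback (isGradedMap_prodMap_dualMap hχ)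
  degree := hP.degree.pullback (isGradedMap_prodMap_dualMap hχ)
  weight_zero m := by
    rw [FormalModuli.pushforward, weightPart_compLinearMap, hP.weight_zero]
    rfl
  weight_one m := by
    rw [FormalModuli.pushforward, weightPart_compLinearMap, hP.weight_one]
    rfl

theorem IsInducedPoisson.transport (h : IsInducedPoisson ω L f Φ P)
    (hf : IsRegularLagrangian ω L f) (hψ : IsStrictMap 𝒢 𝒢' X.Q X'.Q ψ.toLinearMap)
    (hχ : IsStrictMap 𝒯 𝒯' L.Q L'.Q χ.toLinearMap)
    (hω : ∀ x y, ω'.form (ψ x) (ψ y) = ω.form x y) (hff' : ∀ x, ψ (f x) = f' (χ x)) :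
    IsInducedPoisson ω' L' f' (((χ.prodCongr χ.dualMap.symm).symm.trans Φ).trans ψ)
      (pushforward χ P) := by
  have hf' := hf.transport hψ hχ hω hff'
  have hΦ' := h.splitting.transport hψ.map_deg hχ.map_deg hω hff'
  have hP' := h.poisson.polyvector.pushforward hχ.map_deg
  refine hΦ'.isInducedPoisson hf' hP' (funext fun m => ?_)
  have hlinear : weightPart 1 (pushforward χ (splitHamiltonian ω Φ) m) =
      pushforward χ (linearFunction 𝒯 n L.Q) m := by
    rw [pushforward, weightPart_compLinearMap, h.splitting.weightPart_one_splitHamiltonian hf]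
    rfl
  rw [totalHamiltonian, ← hΦ'.weightPart_one_splitHamiltonian hf', splitHamiltonian_transport hψ hω,
    hlinear, ← h.totalHamiltonian_eq hf]
  rfl

end Naturality

end

end FormalModuli

theorem mainTheorem3 {k : Type*} [Field k] [CharZero k] (n : ℤ)
    {G : Type u} [AddCommGroup G] [Module k G] [FiniteDimensional k G] {𝒢 : Grading k G}
    {T : Type v} [AddCommGroup T] [Module k T] [FiniteDimensional k T] {𝒯 : Grading k T}
    (X : LInfinity 𝒢) (ω : ShiftedSymplectic X n) (L : LInfinity 𝒯) (f : T →ₗ[k] G)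
    (hf : IsRegularLagrangian ω L f) :
    -- the normal bundle of `L` in `X` is `T^*[n]L`: the map `f^* T_X → L_L[n]`, `w ↦ ω (w, f -)`,
    -- is a surjective map of vector bundles on `L` whose kernel is `T_L`
    ((∀ ξ : Module.Dual k T, ∃ w : G, ω.form w ∘ₗ f = ξ) ∧
      (∀ w : G, ω.form w ∘ₗ f = 0 ↔ w ∈ LinearMap.range f) ∧
      ∀ (m : ℕ) (v : Fin m → T) (w : Fin m → G),
        twistedCotangent L n 0 m (fun i => (v i, ω.form (w i) ∘ₗ f)) =
          (L.Q m v, ω.form (∑ i, X.Q m (Function.update (fun j => f (v j)) i (w i))) ∘ₗ f)) ∧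
    -- isotropic complements exist, and each of them determines a symplectic splitting
    (∃ M, IsIsotropicComplement ω f M) ∧
    (∀ M, IsIsotropicComplement ω f M →
      ∃! Φ : (T × Module.Dual k T) ≃ₗ[k] G, IsSplitting ω 𝒯 f Φ ∧ ∀ ξ, Φ (0, ξ) ∈ M) ∧
    -- each splitting determines a homotopy Poisson structure on `L`, unique with `T^*_P[n]L ≅ X`
    (∀ Φ, IsSplitting ω 𝒯 f Φ → ∃ P, IsInducedPoisson ω L f Φ P ∧
      ∀ P', IsPolyvector 𝒯 n (n + 1) P' →
        IsStrictMap (𝒯.cotangent n) 𝒢 (twistedCotangent L n P') X.Q Φ.toLinearMap → P' = P) ∧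
    -- it is the deformation to the normal cone: a family over the affine line with fibre
    -- `T^*[n]L` at `0` and with all other fibres isomorphic to `X` by dilating the normal directions
    (∀ Φ P, IsInducedPoisson ω L f Φ P →
      (∀ c : k, IsHomotopyPoisson L n (rescale c P)) ∧ rescale 0 P = 0 ∧ rescale 1 P = P ∧
      ∀ c : k, c ≠ 0 → IsStrictMap (𝒯.cotangent n) 𝒢 (twistedCotangent L n (rescale c P)) X.Q
        (Φ.toLinearMap ∘ₗ dilation k T c)) ∧
    -- it does not depend on the splitting up to gauge equivalence
    (∀ Φ P Φ' P', IsInducedPoisson ω L f Φ P → IsInducedPoisson ω L f Φ' P' →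
      GaugeEquivalent L n P P') ∧
    -- it is natural with respect to isomorphisms of embedded Lagrangians
    (∀ {G' : Type u} [AddCommGroup G'] [Module k G'] [FiniteDimensional k G'] {𝒢' : Grading k G'}
      {T' : Type v} [AddCommGroup T'] [Module k T'] [FiniteDimensional k T'] {𝒯' : Grading k T'}
      (X' : LInfinity 𝒢') (ω' : ShiftedSymplectic X' n) (L' : LInfinity 𝒯') (f' : T' →ₗ[k] G')
      (ψ : G ≃ₗ[k] G') (χ : T ≃ₗ[k] T'),
      IsStrictMap 𝒢 𝒢' X.Q X'.Q ψ.toLinearMap → IsStrictMap 𝒯 𝒯' L.Q L'.Q χ.toLinearMap →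
      (∀ x y, ω'.form (ψ x) (ψ y) = ω.form x y) → (∀ x, ψ (f x) = f' (χ x)) →
      ∀ Φ P, IsInducedPoisson ω L f Φ P →
        IsInducedPoisson ω' L' f'
          (((χ.prodCongr χ.dualMap.symm).symm.trans Φ).trans ψ) (pushforward χ P)) := by
  obtain ⟨σ, hσ⟩ := hf.exists_isotropicSection
  refine ⟨⟨hf.restrictForm_surjective, hf.restrictForm_eq_zero, fun m v w => ?_⟩,
    ⟨_, hσ.isIsotropicComplement_range hf⟩, fun M hM => hM.existsUnique_splitting hf,
    fun Φ hΦ => ?_, fun Φ P h => ?_, fun Φ P Φ' P' h h' => h.gaugeEquivalent h' hf, ?_⟩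
  · obtain ⟨Φ, hΦ, -⟩ := hσ.exists_splitting hf
    exact hΦ.twistedCotangent_zero_apply hf v w
  · have hP := hΦ.isPolyvector_splitPoisson hf
    have hH := hΦ.totalHamiltonian_splitPoisson hf
    refine ⟨splitPoisson ω Φ, hΦ.isInducedPoisson hf hP hH, fun P' hP' h => ?_⟩
    exact totalHamiltonian_injective
      (((hΦ.isStrictMap_twistedCotangent_iff hf hP').1 h).trans hH.symm)
  · exact ⟨h.isHomotopyPoisson_rescale hf, h.poisson.polyvector.rescale_zero, rescale_one P,
      fun c hc => (h.rescale hf c hc).strict⟩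
  · intro G' _ _ _ 𝒢' T' _ _ _ 𝒯' X' ω' L' f' ψ χ hψ hχ hω hff' Φ P h
    exact h.transport hf hψ hχ hω hff'
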